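/- **Corollary 4.9.** Let $k$ be an algebraically closed field, $G$ an abelian group (written additively), and $R$ a commutative affine (i.e. finitely generated) $k$-algebra graded by $G$. Let $c_1,c_2:G\times G\to k^\times$ be alternating bicharacters (homomorphisms in each variable with $c_i(x,x)=1$ for all $x$), and let $A_i$ be the twist of $R$ by $c_i$: the vector space $R$, written as a copy $\{r' : r\in R\}$, with the multiplication determined by $r's'=c_i(x,y)(rs)'$ for $r\in R_x$, $s\in R_y$. Assume that either $-1\notin\langle\operatorname{im}c_1\rangle\cup\langle\operatorname{im}c_2\rangle$ or $\operatorname{char}k=2$, where $\langle\operatorname{im}c_i\rangle$ is the subgroup of $k^\times$ generated by the values of $c_i$. Assume also that, for all $x,y\in G$, $c_2(x,y)=1$ implies $c_1(x,y)=1$. Let $H=\operatorname{Hom}(G,k^\times)$ act on $R$ and on each $A_i$ by the $k$-algebra automorphisms with $h.r=h(x)r$, $h.r'=h(x)r'$ for $r\in R_x$, and hence on the prime spectra $\operatorname{spec}R$ and $\operatorname{spec}A_i$, which carry their Zariski topologies. For $i=1,2$ there is a (necessarily unique) map $\phi_i:\operatorname{spec}R\to\operatorname{spec}A_i$ such that $\phi_i(P)$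 is the largest (two-sided) ideal of $A_i$ contained in $P'=\{r' : r\in P\}$ for every $P\in\operatorname{spec}R$. It is an $H$-equivariant topological quotient map. Moreover, for every finite family $r_1,\dots,r_n$ of homogeneous $k$-algebra generators of $R$, of degrees $\delta_1,\dots,\delta_n$, every $w\subseteq\{1,\dots,n\}$ and every $P\in\operatorname{spec}R$ with $\{j : r_j\in P\}=w$, one has $$\phi_i(P)=\Bigl(\,\bigcap_{h\in S^\perp}h(P)\Bigr)',$$ where $G_w=\sum_{j\notin w}\mathbb Z\delta_j$, $S=\{x\in G_w : c_i(x,y)=1\text{ for all }y\in G_w\}$ and $S^\perp=\{h\in H : h(x)=1\text{ for all }x\in S\}$. Finally, there exists an $H$-equivariant topological quotient map $\phi:\operatorname{spec}A_1\to\operatorname{spec}A_2$ such that $\phi\circ\phi_1=\phi_2$. -/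

import Mathlib

open DirectSum

namespace CocycleTwist

noncomputable section

/-! ### Prime spectra of noncommutative rings -/

section Spectrum

variable (A : Type*) [Ring A]

/-- The prime spectrum `spec A` of a (not necessarily commutative) ring: the proper two-sided
ideals `P` such that, for two-sided ideals `I`, `J`, if the product `I J` is contained in `P`
(i.e. all products `a * b` with `a ∈ I`, `b ∈ J` lie in `P`), then `I ⊆ P` or `J ⊆ P`. -/
@[ext]
structure NCPrimeSpectrum where
  /-- the underlying two-sided ideal -/
  asIdeal : TwoSidedIdeal A
  ne_top : asIdeal ≠ ⊤
  le_or_le : ∀ I J : TwoSidedIdeal A,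
    (∀ a ∈ I, ∀ b ∈ J, a * b ∈ asIdeal) → I ≤ asIdeal ∨ J ≤ asIdeal

variable {A}

/-- The Zariski-closed subset of `spec A` determined by a two-sided ideal `I`. -/
def zeroLocus (I : TwoSidedIdeal A) : Set (NCPrimeSpectrum A) := {P | I ≤ P.asIdeal}

/-- The Zariski topology on `spec A`: the closed sets are exactly the sets `zeroLocus I`. -/
instance : TopologicalSpace (NCPrimeSpectrum A) :=
  TopologicalSpace.ofClosed (Set.range zeroLocus)
    ⟨⊤, by
      ext P
      simpa [zeroLocus] using P.ne_top⟩
    (by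
      intro S hS
      refine ⟨sSup {I | zeroLocus I ∈ S}, ?_⟩
      ext P
      simp only [zeroLocus, Set.mem_ofPred_eq, sSup_le_iff, Set.mem_sInter]
      constructor
      · intro h Z hZ
        obtain ⟨I, rfl⟩ := hS hZ
        exact h I hZ
      · intro h I hI
        exact h _ hI)
    (by
      rintro _ ⟨I, rfl⟩ _ ⟨J, rfl⟩
      refine ⟨I ⊓ J, ?_⟩
      ext P
      simp only [zeroLocus, Set.mem_ofPred_eq, Set.mem_union]
      constructor
      · intro h
        refine P.le_or_le I J fun a ha b hb => h ?_
        exact (TwoSidedIdeal.mem_inf A).2 ⟨I.mul_mem_right _ _ ha, J.mul_mem_left _ _ hb⟩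
      · rintro (h | h)
        · exact inf_le_left.trans h
        · exact inf_le_right.trans h)

lemma isClosed_iff_zeroLocus (Z : Set (NCPrimeSpectrum A)) :
    IsClosed Z ↔ ∃ I : TwoSidedIdeal A, zeroLocus I = Z := by
  rw [← isOpen_compl_iff]
  change Zᶜᶜ ∈ Set.range zeroLocus ↔ _
  rw [compl_compl]
  rfl

/-- The image `e(P)` of a prime ideal `P` under a ring automorphism `e`. -/
def NCPrimeSpectrum.map (e : A ≃+* A) (P : NCPrimeSpectrum A) : NCPrimeSpectrum A where
  asIdeal := e.mapTwoSidedIdeal P.asIdeal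
  ne_top h := P.ne_top (by simpa using h)
  le_or_le I J h := by
    have := P.le_or_le (e.mapTwoSidedIdeal.symm I) (e.mapTwoSidedIdeal.symm J) (by
      intro a ha b hb
      rw [RingEquiv.mapTwoSidedIdeal_symm, RingEquiv.mapTwoSidedIdeal_apply,
        TwoSidedIdeal.mem_comap] at ha hb
      have := h _ ha _ hb
      rw [RingEquiv.mapTwoSidedIdeal_apply, TwoSidedIdeal.mem_comap] at this
      simpa using this)
    simpa only [OrderIso.symm_apply_le] using this

lemma NCPrimeSpectrum.coe_map (e : A ≃+* A) (P : NCPrimeSpectrum A) :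
    ((P.map e).asIdeal : Set A) = e '' (P.asIdeal : Set A) := by
  ext a
  simp only [NCPrimeSpectrum.map, SetLike.mem_coe, RingEquiv.mapTwoSidedIdeal_apply,
    TwoSidedIdeal.mem_comap, Set.mem_image]
  constructor
  · intro h
    exact ⟨_, h, by simp⟩
  · rintro ⟨b, hb, rfl⟩
    simpa using hb

end Spectrum

/-! ### Alternating bicharacters -/

/-- An alternating bicharacter on the (additively written) abelian group `G`: a map
`c : G × G → kˣ` which is a homomorphism in each variable and satisfies `c(x,x) = 1`. -/
structure AlternatingBicharacter (G k : Type*) [AddCommGroup G] [Field k] where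
  /-- the underlying map -/
  toFun : G → G → kˣ
  map_add_left : ∀ x y z, toFun (x + y) z = toFun x z * toFun y z
  map_add_right : ∀ x y z, toFun x (y + z) = toFun x y * toFun x z
  map_self : ∀ x, toFun x x = 1

namespace AlternatingBicharacter

variable {G k : Type*} [AddCommGroup G] [Field k]

instance : CoeFun (AlternatingBicharacter G k) fun _ => G → G → kˣ := ⟨toFun⟩

variable (c : AlternatingBicharacter G k)

lemma map_zero_left (y : G) : c 0 y = 1 := by
  have h := c.map_add_left 0 0 y
  rw [add_zero] at h
  exact left_eq_mul.1 h

lemma map_zero_right (x : G) : c x 0 = 1 := by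
  have h := c.map_add_right x 0 0
  rw [add_zero] at h
  exact left_eq_mul.1 h

/-- The subgroup `⟨im c⟩` of `kˣ` generated by the values of `c`. -/
def imageSubgroup : Subgroup kˣ := Subgroup.closure {u | ∃ x y, c x y = u}

/-- The radical of the restriction of `c` to a subgroup `N` of `G`:
all `x ∈ N` such that `c(x,y) = 1` for all `y ∈ N`. -/
def radicalOn (N : AddSubgroup G) : Set G := {x | x ∈ N ∧ ∀ y ∈ N, c x y = 1}

end AlternatingBicharacter

/-- The orthogonal of a subset `S ⊆ G` in `H = Hom(G, kˣ)`: all `h` which are trivial on `S`.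
(`AddChar G kˣ` is the group, under pointwise multiplication, of all homomorphisms from the
additive group `G` to the multiplicative group `kˣ`.) -/
def perp {G k : Type*} [AddCommGroup G] [Field k] (S : Set G) : Set (AddChar G kˣ) :=
  {h | ∀ x ∈ S, h x = 1}

/-! ### Graded algebras, cocycle twists and the action of the character group -/

section Twist

variable {k R G : Type*} [Field k] [CommRing R] [Algebra k R] [AddCommGroup G] [DecidableEq G]
variable (𝒜 : G → Submodule k R) [GradedAlgebra 𝒜]

/-- The `k`-linear endomorphism of a `G`-graded algebra which multiplies the homogeneous
elements of degree `x` by the scalar `χ x`. -/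
def weight (χ : G → kˣ) : R →ₗ[k] R :=
  DirectSum.toModule k G R (fun x => (χ x : k) • (𝒜 x).subtype) ∘ₗ
    (decomposeLinearEquiv 𝒜).toLinearMap

lemma weight_of_mem (χ : G → kˣ) {x : G} {r : R} (hr : r ∈ 𝒜 x) :
    weight 𝒜 χ r = (χ x : k) • r := by
  lift r to 𝒜 x using hr
  rw [weight, LinearMap.comp_apply, LinearEquiv.coe_coe, decomposeLinearEquiv_apply_coe,
    DirectSum.toModule_lof]
  rfl

lemma weight_mul (h : AddChar G kˣ) (r s : R) :
    weight 𝒜 h (r * s) = weight 𝒜 h r * weight 𝒜 h s := by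
  induction r using Decomposition.inductionOn 𝒜 with
  | zero => simp
  | add a b ha hb => simp only [add_mul, map_add, ha, hb]
  | @homogeneous x a =>
    induction s using Decomposition.inductionOn 𝒜 with
    | zero => simp
    | add a b ha hb => simp only [mul_add, map_add, ha, hb]
    | @homogeneous y b =>
      rw [weight_of_mem 𝒜 h (SetLike.mul_mem_graded a.2 b.2), weight_of_mem 𝒜 h a.2,
        weight_of_mem 𝒜 h b.2, h.map_add_eq_mul, smul_mul_smul_comm, Units.val_mul]

lemma weight_weight (χ ψ : G → kˣ) (r : R) :
    weight 𝒜 χ (weight 𝒜 ψ r) = weight 𝒜 (χ * ψ) r := by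
  induction r using Decomposition.inductionOn 𝒜 with
  | zero => simp
  | add a b ha hb => simp only [map_add, ha, hb]
  | @homogeneous x a =>
    rw [weight_of_mem 𝒜 ψ a.2, map_smul, weight_of_mem 𝒜 χ a.2, weight_of_mem 𝒜 _ a.2, smul_smul,
      Pi.mul_apply, Units.val_mul, mul_comm]

lemma weight_one (r : R) : weight 𝒜 (1 : G → kˣ) r = r := by
  induction r using Decomposition.inductionOn 𝒜 with
  | zero => simp
  | add a b ha hb => simp only [map_add, ha, hb]
  | @homogeneous x a => simp [weight_of_mem 𝒜 (1 : G → kˣ) a.2]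

lemma weight_apply_one (h : AddChar G kˣ) : weight 𝒜 h (1 : R) = 1 := by
  rw [weight_of_mem 𝒜 h (SetLike.one_mem_graded 𝒜)]
  simp

/-- The action of `h ∈ H = Hom(G, kˣ)` on the `G`-graded algebra `R` by a `k`-algebra
automorphism: `h.r = h(x) r` for `r` homogeneous of degree `x`. -/
def charAut (h : AddChar G kˣ) : R ≃ₐ[k] R :=
  AlgEquiv.ofAlgHom
    (AlgHom.ofLinearMap (weight 𝒜 h) (weight_apply_one 𝒜 h) (weight_mul 𝒜 h))
    (AlgHom.ofLinearMap (weight 𝒜 (h⁻¹ : AddChar G kˣ)) (weight_apply_one 𝒜 _) (weight_mul 𝒜 _))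
    (by
      ext r
      simp only [AlgHom.comp_apply, AlgHom.ofLinearMap_apply, weight_weight, AlgHom.id_apply]
      rw [← AddChar.coe_mul, mul_inv_cancel]
      exact weight_one 𝒜 r)
    (by
      ext r
      simp only [AlgHom.comp_apply, AlgHom.ofLinearMap_apply, weight_weight, AlgHom.id_apply]
      rw [← AddChar.coe_mul, inv_mul_cancel]
      exact weight_one 𝒜 r)

lemma charAut_of_mem (h : AddChar G kˣ) {x : G} {r : R} (hr : r ∈ 𝒜 x) :
    charAut 𝒜 h r = (h x : k) • r :=
  weight_of_mem 𝒜 h hr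

/-- The induced action of `H` on `spec R`: `h.P = h(P)`, realized as the preimage of `P`
under the inverse automorphism. -/
def specAct (h : AddChar G kˣ) (P : PrimeSpectrum R) : PrimeSpectrum R :=
  PrimeSpectrum.comap ((charAut 𝒜 h).symm : R →+* R) P

lemma coe_specAct (h : AddChar G kˣ) (P : PrimeSpectrum R) :
    ((specAct 𝒜 h P).asIdeal : Set R) = charAut 𝒜 h '' (P.asIdeal : Set R) := by
  ext a
  simp only [specAct, PrimeSpectrum.comap_asIdeal, SetLike.mem_coe, Ideal.mem_comap,
    Set.mem_image]
  constructor
  · intro h'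
    exact ⟨_, h', by simp⟩
  · rintro ⟨b, hb, rfl⟩
    simpa using hb

/-- The multiplication `r * s = c(x,y) r s` (for `r`, `s` homogeneous of degrees `x`, `y`), as a
bilinear map on `R`. -/
def twistMul (c : AlternatingBicharacter G k) : R →ₗ[k] R →ₗ[k] R :=
  DirectSum.toModule k G (R →ₗ[k] R)
      (fun x => ((LinearMap.mul k R).compl₂ (weight 𝒜 (c x))).domRestrict (𝒜 x)) ∘ₗ
    (decomposeLinearEquiv 𝒜).toLinearMap

lemma twistMul_of_mem (c : AlternatingBicharacter G k) {x y : G} {r s : R}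
    (hr : r ∈ 𝒜 x) (hs : s ∈ 𝒜 y) : twistMul 𝒜 c r s = (c x y : k) • (r * s) := by
  lift r to 𝒜 x using hr
  rw [twistMul, LinearMap.comp_apply, LinearEquiv.coe_coe, decomposeLinearEquiv_apply_coe,
    DirectSum.toModule_lof, LinearMap.domRestrict_apply, LinearMap.compl₂_apply,
    weight_of_mem 𝒜 (c x) hs, LinearMap.mul_apply', mul_smul_comm]

/-- The twist of the `G`-graded algebra `R` by `c` (a bicharacter is in particular a 2-cocycle):
the vector space `R` with the new multiplication `twistMul`. -/
@[nolint unusedArguments]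
def Twist (_𝒜 : G → Submodule k R) (_c : AlternatingBicharacter G k) : Type _ := R

variable (c : AlternatingBicharacter G k)

instance instAddCommGroupTwist : AddCommGroup (Twist 𝒜 c) := inferInstanceAs (AddCommGroup R)

instance : Module k (Twist 𝒜 c) := inferInstanceAs (Module k R)

/-- The twist map `r ↦ r'` from `R` to its twist. -/
def toTwist : R ≃ₗ[k] Twist 𝒜 c := LinearEquiv.refl k R

instance : Mul (Twist 𝒜 c) :=
  ⟨fun a b => toTwist 𝒜 c (twistMul 𝒜 c ((toTwist 𝒜 c).symm a) ((toTwist 𝒜 c).symm b))⟩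

instance : One (Twist 𝒜 c) := ⟨toTwist 𝒜 c 1⟩

lemma toTwist_mul (r s : R) :
    toTwist 𝒜 c r * toTwist 𝒜 c s = toTwist 𝒜 c (twistMul 𝒜 c r s) := rfl

lemma toTwist_one : toTwist 𝒜 c 1 = 1 := rfl

/-- The defining rule `r' s' = c(x,y) (rs)'` for homogeneous `r`, `s` of degrees `x`, `y`. -/
lemma toTwist_mul_of_mem {x y : G} {r s : R} (hr : r ∈ 𝒜 x) (hs : s ∈ 𝒜 y) :
    toTwist 𝒜 c r * toTwist 𝒜 c s = (c x y : k) • toTwist 𝒜 c (r * s) := by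
  rw [toTwist_mul, twistMul_of_mem 𝒜 c hr hs, map_smul]

lemma twistMul_one_left (r : R) : twistMul 𝒜 c 1 r = r := by
  induction r using Decomposition.inductionOn 𝒜 with
  | zero => simp
  | add a b ha hb => simp only [map_add, ha, hb]
  | @homogeneous x a =>
    rw [twistMul_of_mem 𝒜 c (SetLike.one_mem_graded 𝒜) a.2, c.map_zero_left]
    simp

lemma twistMul_one_right (r : R) : twistMul 𝒜 c r 1 = r := by
  induction r using Decomposition.inductionOn 𝒜 with
  | zero => simp
  | add a b ha hb => simp only [map_add, LinearMap.add_apply, ha, hb]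
  | @homogeneous x a =>
    rw [twistMul_of_mem 𝒜 c a.2 (SetLike.one_mem_graded 𝒜), c.map_zero_right]
    simp

lemma twistMul_assoc (r s t : R) :
    twistMul 𝒜 c (twistMul 𝒜 c r s) t = twistMul 𝒜 c r (twistMul 𝒜 c s t) := by
  induction r using Decomposition.inductionOn 𝒜 with
  | zero => simp
  | add a b ha hb => simp only [map_add, LinearMap.add_apply, ha, hb]
  | @homogeneous x a =>
    induction s using Decomposition.inductionOn 𝒜 with
    | zero => simp
    | add a b ha hb => simp only [map_add, LinearMap.add_apply, ha, hb]
    | @homogeneous y b =>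
      induction t using Decomposition.inductionOn 𝒜 with
      | zero => simp
      | add a b ha hb => simp only [map_add, ha, hb]
      | @homogeneous z d =>
        rw [twistMul_of_mem 𝒜 c a.2 b.2, twistMul_of_mem 𝒜 c b.2 d.2, map_smul, map_smul,
          LinearMap.smul_apply, twistMul_of_mem 𝒜 c (SetLike.mul_mem_graded a.2 b.2) d.2,
          twistMul_of_mem 𝒜 c a.2 (SetLike.mul_mem_graded b.2 d.2), smul_smul, smul_smul,
          c.map_add_left, c.map_add_right, mul_assoc (a : R)]
        congr 1
        push_cast
        ring

instance instRingTwist : Ring (Twist 𝒜 c) where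
  __ := instAddCommGroupTwist 𝒜 c
  mul := (· * ·)
  one := 1
  left_distrib a b d := by
    obtain ⟨a, rfl⟩ := (toTwist 𝒜 c).surjective a
    obtain ⟨b, rfl⟩ := (toTwist 𝒜 c).surjective b
    obtain ⟨d, rfl⟩ := (toTwist 𝒜 c).surjective d
    change toTwist 𝒜 c a * (toTwist 𝒜 c b + toTwist 𝒜 c d) =
      toTwist 𝒜 c a * toTwist 𝒜 c b + toTwist 𝒜 c a * toTwist 𝒜 c d
    rw [← map_add, toTwist_mul, toTwist_mul, toTwist_mul, ← map_add, map_add]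
  right_distrib a b d := by
    obtain ⟨a, rfl⟩ := (toTwist 𝒜 c).surjective a
    obtain ⟨b, rfl⟩ := (toTwist 𝒜 c).surjective b
    obtain ⟨d, rfl⟩ := (toTwist 𝒜 c).surjective d
    change (toTwist 𝒜 c a + toTwist 𝒜 c b) * toTwist 𝒜 c d =
      toTwist 𝒜 c a * toTwist 𝒜 c d + toTwist 𝒜 c b * toTwist 𝒜 c d
    rw [← map_add, toTwist_mul, toTwist_mul, toTwist_mul, ← map_add, map_add,
      LinearMap.add_apply]
  zero_mul a := by
    obtain ⟨a, rfl⟩ := (toTwist 𝒜 c).surjective a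
    change toTwist 𝒜 c 0 * toTwist 𝒜 c a = toTwist 𝒜 c 0
    rw [toTwist_mul, map_zero, LinearMap.zero_apply]
  mul_zero a := by
    obtain ⟨a, rfl⟩ := (toTwist 𝒜 c).surjective a
    change toTwist 𝒜 c a * toTwist 𝒜 c 0 = toTwist 𝒜 c 0
    rw [toTwist_mul, map_zero]
  mul_assoc a b d := by
    obtain ⟨a, rfl⟩ := (toTwist 𝒜 c).surjective a
    obtain ⟨b, rfl⟩ := (toTwist 𝒜 c).surjective b
    obtain ⟨d, rfl⟩ := (toTwist 𝒜 c).surjective d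
    change toTwist 𝒜 c a * toTwist 𝒜 c b * toTwist 𝒜 c d =
      toTwist 𝒜 c a * (toTwist 𝒜 c b * toTwist 𝒜 c d)
    simp only [toTwist_mul, twistMul_assoc]
  one_mul a := by
    obtain ⟨a, rfl⟩ := (toTwist 𝒜 c).surjective a
    change toTwist 𝒜 c 1 * toTwist 𝒜 c a = toTwist 𝒜 c a
    rw [toTwist_mul, twistMul_one_left]
  mul_one a := by
    obtain ⟨a, rfl⟩ := (toTwist 𝒜 c).surjective a
    change toTwist 𝒜 c a * toTwist 𝒜 c 1 = toTwist 𝒜 c a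
    rw [toTwist_mul, twistMul_one_right]

instance : Algebra k (Twist 𝒜 c) :=
  Algebra.ofModule
    (by
      intro t a b
      obtain ⟨a, rfl⟩ := (toTwist 𝒜 c).surjective a
      obtain ⟨b, rfl⟩ := (toTwist 𝒜 c).surjective b
      rw [← map_smul, toTwist_mul, toTwist_mul, map_smul, LinearMap.smul_apply, map_smul])
    (by
      intro t a b
      obtain ⟨a, rfl⟩ := (toTwist 𝒜 c).surjective a
      obtain ⟨b, rfl⟩ := (toTwist 𝒜 c).surjective b
      rw [← map_smul, toTwist_mul, toTwist_mul, map_smul, map_smul])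

lemma charAut_twistMul (h : AddChar G kˣ) (r s : R) :
    charAut 𝒜 h (twistMul 𝒜 c r s) = twistMul 𝒜 c (charAut 𝒜 h r) (charAut 𝒜 h s) := by
  induction r using Decomposition.inductionOn 𝒜 with
  | zero => simp
  | add a b ha hb => simp only [map_add, LinearMap.add_apply, ha, hb]
  | @homogeneous x a =>
    induction s using Decomposition.inductionOn 𝒜 with
    | zero => simp
    | add a b ha hb => simp only [map_add, ha, hb]
    | @homogeneous y b =>
      rw [twistMul_of_mem 𝒜 c a.2 b.2, map_smul, map_mul, charAut_of_mem 𝒜 h a.2,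
        charAut_of_mem 𝒜 h b.2, map_smul, map_smul, LinearMap.smul_apply,
        twistMul_of_mem 𝒜 c a.2 b.2, smul_mul_smul_comm, smul_smul, smul_smul, smul_smul]
      congr 1
      ring

/-- The action of `h ∈ H = Hom(G, kˣ)` on the twist by a `k`-algebra automorphism:
`h.r' = (h.r)'`, that is, `h.a = h(x) a` for `a` homogeneous of degree `x`. -/
def twistCharAut (h : AddChar G kˣ) : Twist 𝒜 c ≃ₐ[k] Twist 𝒜 c :=
  AlgEquiv.ofLinearEquiv
    (((toTwist 𝒜 c).symm.trans (charAut 𝒜 h).toLinearEquiv).trans (toTwist 𝒜 c))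
    (by
      rw [← toTwist_one]
      simp)
    (by
      intro a b
      obtain ⟨a, rfl⟩ := (toTwist 𝒜 c).surjective a
      obtain ⟨b, rfl⟩ := (toTwist 𝒜 c).surjective b
      rw [toTwist_mul]
      simp [toTwist_mul, charAut_twistMul])

lemma twistCharAut_of_mem (h : AddChar G kˣ) {x : G} {r : R} (hr : r ∈ 𝒜 x) :
    twistCharAut 𝒜 c h (toTwist 𝒜 c r) = (h x : k) • toTwist 𝒜 c r := by
  simp [twistCharAut, charAut_of_mem 𝒜 h hr]

/-- The induced action of `H` on the prime spectrum of the twist: `h.Q = h(Q)`. -/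
def twistSpecAct (h : AddChar G kˣ) (Q : NCPrimeSpectrum (Twist 𝒜 c)) :
    NCPrimeSpectrum (Twist 𝒜 c) :=
  Q.map (twistCharAut 𝒜 c h).toRingEquiv

/-- The ideal `(P : T) = ⋂_{t ∈ T} t(P)` of `R`, for `T ⊆ H` and a prime ideal `P` of `R`. -/
def orbitInf (P : PrimeSpectrum R) (T : Set (AddChar G kˣ)) : Ideal R :=
  ⨅ t ∈ T, (specAct 𝒜 t P).asIdeal

/-- The stratum `spec_w R`, relative to elements `r₁, …, rₙ` of `R` and `w ⊆ {1, …, n}`: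
the primes `P` such that `rᵢ ∈ P` if and only if `i ∈ w`. -/
def specStratum {n : ℕ} (r : Fin n → R) (w : Set (Fin n)) : Set (PrimeSpectrum R) :=
  {P | ∀ i, r i ∈ P.asIdeal ↔ i ∈ w}

/-- The subgroup `G_w` of `G` generated by the `δᵢ` with `i ∉ w`. -/
def stratumSubgroup {n : ℕ} (δ : Fin n → G) (w : Set (Fin n)) : AddSubgroup G :=
  AddSubgroup.closure (δ '' wᶜ)

/-- `φ` is the canonical `H`-equivariant topological quotient map from `spec R` to `spec A`, where
`A` is the twist of `R` by `c`.  Each of the last two fields determines the map `φ` uniquely. -/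
structure IsCanonicalQuotient (φ : PrimeSpectrum R → NCPrimeSpectrum (Twist 𝒜 c)) : Prop where
  isQuotientMap : Topology.IsQuotientMap φ
  equivariant : ∀ h P, φ (specAct 𝒜 h P) = twistSpecAct 𝒜 c h (φ P)
  /-- For every choice of homogeneous `k`-algebra generators `rᵢ` of degrees `δᵢ`, and for `P` in
  `spec_w R`, one has `φ(P) = (P : rad(c_w)^⊥)'`, where `c_w` is the restriction of `c` to `G_w`. -/
  eq_on_stratum : ∀ (n : ℕ) (r : Fin n → R) (δ : Fin n → G), (∀ i, r i ∈ 𝒜 (δ i)) →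
    Algebra.adjoin k (Set.range r) = ⊤ → ∀ w : Set (Fin n), ∀ P ∈ specStratum r w,
      ((φ P).asIdeal : Set (Twist 𝒜 c)) =
        toTwist 𝒜 c '' (orbitInf 𝒜 P (perp (c.radicalOn (stratumSubgroup δ w))) : Set R)
  /-- `φ(P)` is the largest two-sided ideal of `A` contained in `P'`. -/
  isGreatest : ∀ P : PrimeSpectrum R,
    IsGreatest {I : TwoSidedIdeal (Twist 𝒜 c) |
      (I : Set (Twist 𝒜 c)) ⊆ toTwist 𝒜 c '' (P.asIdeal : Set R)} (φ P).asIdeal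

end Twist

end

end CocycleTwist

/-! Let `N` be the subgroup generated by the degrees of the homogeneous elements outside a prime
`P`. Twisted left and right multiplication by `m` of degree `x` send `a` to `m` times `a` reweighted
by c(x,-), respectively c(-x,-). Modulo `P` such an `m` can be cancelled, so an ideal of the twist
inside `P'` lies in every translate of `P` by a character c(x,-) with `x ∈ N`. The intersection of
these translates, `core`, is itself an ideal of the twist, hence the largest one in `P'`.

Everything else rests on eliminating homogeneous components. A subspace stable under the weights
c(x,-) is spanned by elements whose degrees in `N` these weights cannot tell apart
(`le_of_coherent_mem`). On such an element any character with the same indistinguishable degrees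
acts by a scalar, modulo the components outside `N`; so the subspace is stable under that character
too (`weight_mem_of_stable`). This gives the formula with the orthogonal of the radical and the
comparison of the two twists.

Two-sided ideals only compare c(x,-) with c(-x,-), so they see the squares of the values of `c`. The
hypothesis on -1 says that squares separate degrees as well as the values do. It is used for
primeness of the core (`exists_isCoherent`, `coreIdeal_le_or_le`) and to show that a prime of the
twist is stable under the weights, hence is also an ideal `I` of `R` (`weight_mem_untwist`). An
ideal maximal among those containing `I` with core inside `I` is then a prime mapping to it
(`canonicalMap_surjective`). -/

namespace CocycleTwist

noncomputable section

variable {k R G : Type*} [Field k] [AddCommGroup G]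

/-! ### Bicharacters and the role of -1. -/

namespace AlternatingBicharacter

variable (c : AlternatingBicharacter G k)

/-- The character `c(x, -)`. -/
def toChar (x : G) : AddChar G kˣ where
  toFun := c x
  map_zero_eq_one' := c.map_zero_right x
  map_add_eq_mul' := c.map_add_right x

lemma coe_toChar (x : G) : ⇑(c.toChar x) = c x := rfl

lemma map_neg_left (x y : G) : c (-x) y = (c x y)⁻¹ := by
  rw [eq_inv_iff_mul_eq_one, ← c.map_add_left, neg_add_cancel, c.map_zero_left]

lemma map_neg_right (x y : G) : c x (-y) = (c x y)⁻¹ := by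
  rw [eq_inv_iff_mul_eq_one, ← c.map_add_right, neg_add_cancel, c.map_zero_right]

lemma map_sub_right (x y z : G) : c x (y - z) = c x y / c x z := by
  rw [sub_eq_add_neg, c.map_add_right, c.map_neg_right, div_eq_mul_inv]

lemma map_swap (x y : G) : c y x = (c x y)⁻¹ := by
  have h := c.map_self (x + y)
  rw [c.map_add_left, c.map_add_right, c.map_add_right, c.map_self, c.map_self, one_mul,
    mul_one, mul_comm] at h
  exact eq_inv_of_mul_eq_one_left h

lemma eq_of_forall_closure {D : Set G} {y z : G} (h : ∀ x ∈ D, c x y = c x z) :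
    ∀ x ∈ AddSubgroup.closure D, c x y = c x z := by
  intro x hx
  induction hx using AddSubgroup.closure_induction with
  | mem x hx => exact h x hx
  | zero => rw [c.map_zero_left, c.map_zero_left]
  | add a b _ _ ha hb => rw [c.map_add_left, c.map_add_left, ha, hb]
  | neg a _ ha => rw [c.map_neg_left, c.map_neg_left, ha]

/-- No value of `c` is an element of order two. -/
def SquareFaithful : Prop := ∀ x y, c x y * c x y = 1 → c x y = 1

variable {c}

/-- The form in which the hypothesis on -1 is used: c(2x,-) separates degrees as finely as c(x,-).
-/
lemma SquareFaithful.eq_of_mul_self_eq (hc : c.SquareFaithful) {x y z : G}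
    (h : c x y * c x y = c x z * c x z) : c x y = c x z := by
  rw [← div_eq_one, ← c.map_sub_right]
  apply hc
  rw [c.map_sub_right, div_mul_div_comm, h, div_self']

lemma SquareFaithful.of_neg_one (h : (-1 : kˣ) ∉ c.imageSubgroup ∨ CharP k 2) :
    c.SquareFaithful := by
  intro x y hxy
  have hk : (c x y : k) * (c x y : k) = 1 := by
    rw [← Units.val_mul, hxy, Units.val_one]
  rcases mul_self_eq_one_iff.1 hk with h1 | h1
  · exact Units.ext h1
  · have h2 : c x y = -1 := Units.ext (by simpa using h1)
    rcases h with h | h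
    · exact absurd (h2 ▸ Subgroup.subset_closure ⟨x, y, rfl⟩) h
    · rw [h2]
      exact Units.ext (by simpa using CharTwo.neg_eq (1 : k))

end AlternatingBicharacter

variable [CommRing R] [Algebra k R] [DecidableEq G]
variable (𝒜 : G → Submodule k R) [GradedAlgebra 𝒜] (c : AlternatingBicharacter G k)

/-! ### Weight operators. -/

section Weight

lemma mem_of_components {K : Submodule k R} {a : R} (h : ∀ y, (decompose 𝒜 a y : R) ∈ K) :
    a ∈ K := by
  classical
  rw [← sum_support_decompose 𝒜 a]
  exact sum_mem fun y _ => h y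

lemma decompose_weight (χ : G → kˣ) (a : R) (y : G) :
    (decompose 𝒜 (weight 𝒜 χ a) y : R) = (χ y : k) • (decompose 𝒜 a y : R) := by
  induction a using Decomposition.inductionOn 𝒜 with
  | zero => simp
  | add a b ha hb => simp only [map_add, decompose_add, DirectSum.add_apply, Submodule.coe_add, ha, hb,
      smul_add]
  | @homogeneous x a =>
    rw [weight_of_mem 𝒜 χ a.2, decompose_smul]
    change (χ x : k) • (decompose 𝒜 (a : R) y : R) = _
    by_cases hxy : x = y
    · subst hxy
      rfl
    · rw [decompose_of_mem_ne 𝒜 a.2 hxy, smul_zero, smul_zero]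

lemma weight_const (u : kˣ) (a : R) : weight 𝒜 (fun _ => u) a = (u : k) • a := by
  induction a using Decomposition.inductionOn 𝒜 with
  | zero => simp
  | add a b ha hb => simp only [map_add, ha, hb, smul_add]
  | homogeneous a => rw [weight_of_mem 𝒜 _ a.2]

lemma weight_comm (χ ψ : G → kˣ) (a : R) :
    weight 𝒜 χ (weight 𝒜 ψ a) = weight 𝒜 ψ (weight 𝒜 χ a) := by
  rw [weight_weight, weight_weight, mul_comm]

lemma weight_add_apply (x y : G) (a : R) :
    weight 𝒜 (c (x + y)) a = weight 𝒜 (c x) (weight 𝒜 (c y) a) := by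
  rw [weight_weight]
  congr 2
  funext z
  exact c.map_add_left x y z

lemma weight_zero_apply (a : R) : weight 𝒜 (c 0) a = a := by
  rw [show ⇑c 0 = 1 from funext c.map_zero_left, weight_one]

lemma weight_neg_weight (x : G) (a : R) : weight 𝒜 (c (-x)) (weight 𝒜 (c x) a) = a := by
  rw [← weight_add_apply, neg_add_cancel, weight_zero_apply]

lemma weight_weight_neg (x : G) (a : R) : weight 𝒜 (c x) (weight 𝒜 (c (-x)) a) = a := by
  rw [← weight_add_apply, add_neg_cancel, weight_zero_apply]

lemma weight_bichar_mul (x : G) (a b : R) :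
    weight 𝒜 (c x) (a * b) = weight 𝒜 (c x) a * weight 𝒜 (c x) b :=
  weight_mul 𝒜 (c.toChar x) a b

/-- Since `K` absorbs every component outside `N`, only the values of the weights on the support of
`a` in `N` matter. -/
lemma weight_sub_weight_mem {K : Submodule k R} {N : Set G}
    (hN : ∀ y ∉ N, ∀ r ∈ 𝒜 y, r ∈ K) {χ ψ : G → kˣ} {a : R}
    (h : ∀ y ∈ N, (decompose 𝒜 a y : R) ≠ 0 → χ y = ψ y) :
    weight 𝒜 χ a - weight 𝒜 ψ a ∈ K := by
  refine mem_of_components 𝒜 fun y => ?_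
  rw [decompose_sub]
  change (decompose 𝒜 (weight 𝒜 χ a) y : R) - (decompose 𝒜 (weight 𝒜 ψ a) y : R) ∈ K
  rw [decompose_weight, decompose_weight]
  by_cases hy : y ∈ N
  · by_cases h0 : (decompose 𝒜 a y : R) = 0
    · simp [h0]
    · rw [h y hy h0, sub_self]
      exact K.zero_mem
  · exact K.sub_mem (K.smul_mem _ (hN y hy _ (SetLike.coe_mem _)))
      (K.smul_mem _ (hN y hy _ (SetLike.coe_mem _)))

end Weight

/-! ### Coherent elements and stability under weights. -/

section Coherent

/-- An element is coherent if the characters `c(x, -)`, `x ∈ N`, do not distinguish the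
degrees in `N` of its nonzero homogeneous components. -/
def IsCoherent (N : AddSubgroup G) (a : R) : Prop :=
  ∀ y ∈ N, ∀ z ∈ N, (decompose 𝒜 a y : R) ≠ 0 → (decompose 𝒜 a z : R) ≠ 0 →
    ∀ x ∈ N, c x y = c x z

variable {𝒜 c}

/-- A subspace stable under sufficiently many weight operators is spanned by its coherent
elements. -/
lemma le_of_coherent_mem {K L : Submodule k R} {N : AddSubgroup G} {X : Set G}
    (hX : ∀ x ∈ X, ∀ a ∈ K, weight 𝒜 (c x) a ∈ K)
    (hsep : ∀ y ∈ N, ∀ z ∈ N, (∀ x ∈ X, c x y = c x z) → ∀ x ∈ N, c x y = c x z)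
    (h : ∀ a ∈ K, IsCoherent 𝒜 c N a → a ∈ L) : K ≤ L := by
  classical
  suffices H : ∀ F : Finset G, ∀ a ∈ K, (∀ y ∉ F, (decompose 𝒜 a y : R) = 0) → a ∈ L by
    intro a ha
    refine H (decompose 𝒜 a).support a ha fun y hy => ?_
    rw [DFinsupp.notMem_support_iff.1 hy]
    rfl
  intro F
  induction F using Finset.strongInduction with
  | H F ih =>
    intro a ha hF
    by_cases hcoh : IsCoherent 𝒜 c N a
    · exact h a ha hcoh
    simp only [IsCoherent, not_forall] at hcoh
    obtain ⟨y, hy, z, hz, hay, haz, hne⟩ := hcoh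
    have hne' : ∃ x ∈ X, c x y ≠ c x z := by
      by_contra! h'
      obtain ⟨x, hx, hxx⟩ := hne
      exact hxx (hsep y hy z hz h' x hx)
    obtain ⟨x, hx, hxyz⟩ := hne'
    -- This combination kills the component of degree `w`, so the induction applies. Comparing `w =
    -- y` with `w = z` leaves a nonzero multiple of `a`.
    have key : ∀ w, (decompose 𝒜 a w : R) ≠ 0 →
        weight 𝒜 (c x) a - (c x w : k) • a ∈ L := by
      intro w hw
      have hwF : w ∈ F := by
        by_contra h'
        exact hw (hF w h')
      refine ih (F.erase w) (Finset.erase_ssubset hwF) _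
        (K.sub_mem (hX x hx a ha) (K.smul_mem _ ha)) fun v hv => ?_
      rw [← weight_const 𝒜, decompose_sub]
      change (decompose 𝒜 (weight 𝒜 (c x) a) v : R) -
        (decompose 𝒜 (weight 𝒜 (fun _ => c x w) a) v : R) = 0
      rw [decompose_weight, decompose_weight]
      by_cases hvw : v = w
      · rw [hvw, sub_self]
      · rw [hF v fun h' => hv (Finset.mem_erase.2 ⟨hvw, h'⟩), smul_zero, smul_zero, sub_self]
    have h1 := L.sub_mem (key z haz) (key y hay)
    have h2 : weight 𝒜 (c x) a - (c x z : k) • a - (weight 𝒜 (c x) a - (c x y : k) • a) =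
        ((c x y : k) - c x z) • a := by
      rw [sub_smul]
      abel
    rw [h2] at h1
    refine (L.smul_mem_iff ?_).1 h1
    rw [sub_ne_zero]
    exact fun h' => hxyz (Units.ext h')

lemma IsCoherent.weight_sub_smul_mem {K : Submodule k R} {N : AddSubgroup G}
    (hN : ∀ y ∉ N, ∀ r ∈ 𝒜 y, r ∈ K) {a : R} (ha : IsCoherent 𝒜 c N a) {χ : G → kˣ}
    (hχ : ∀ y ∈ N, ∀ z ∈ N, (∀ x ∈ N, c x y = c x z) → χ y = χ z) {y : G} (hy : y ∈ N)
    (hay : (decompose 𝒜 a y : R) ≠ 0) : weight 𝒜 χ a - (χ y : k) • a ∈ K := by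
  rw [← weight_const 𝒜]
  exact weight_sub_weight_mem 𝒜 (N := N) hN fun z hz haz => hχ z hz y hy (ha z hz y hy haz hay)

/-- It suffices to treat coherent elements, on which `χ` acts as a scalar modulo the components
outside `N`. The set `X` may be smaller than `N` as long as it separates the same degrees. -/
lemma weight_mem_of_stable {K : Submodule k R} {N : AddSubgroup G} {X : Set G}
    (hN : ∀ y ∉ N, ∀ r ∈ 𝒜 y, r ∈ K)
    (hX : ∀ x ∈ X, ∀ a ∈ K, weight 𝒜 (c x) a ∈ K)
    (hsep : ∀ y ∈ N, ∀ z ∈ N, (∀ x ∈ X, c x y = c x z) → ∀ x ∈ N, c x y = c x z)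
    {χ : G → kˣ} (hχ : ∀ y ∈ N, ∀ z ∈ N, (∀ x ∈ N, c x y = c x z) → χ y = χ z)
    {a : R} (ha : a ∈ K) : weight 𝒜 χ a ∈ K := by
  suffices K ≤ K.comap (weight 𝒜 χ) from this ha
  refine le_of_coherent_mem hX hsep fun a ha hcoh => ?_
  rw [Submodule.mem_comap]
  by_cases h : ∃ y ∈ N, (decompose 𝒜 a y : R) ≠ 0
  · obtain ⟨y, hy, hay⟩ := h
    exact (K.sub_mem_iff_left (K.smul_mem _ ha)).1 (hcoh.weight_sub_smul_mem hN hχ hy hay)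
  · push Not at h
    have := weight_sub_weight_mem 𝒜 (N := N) hN (χ := χ) (ψ := 1) (a := a)
      fun y hy h' => absurd (h y hy) h'
    rw [weight_one] at this
    exact (K.sub_mem_iff_left ha).1 this

end Coherent

/-! ### Twisted multiplication and ideals of the twist. -/

section TwistMul

lemma twistMul_of_mem_left {x : G} {r : R} (hr : r ∈ 𝒜 x) (a : R) :
    twistMul 𝒜 c r a = r * weight 𝒜 (c x) a := by
  induction a using Decomposition.inductionOn 𝒜 with
  | zero => simp
  | add a b ha hb => simp only [map_add, mul_add, ha, hb]
  | @homogeneous y a =>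
    rw [twistMul_of_mem 𝒜 c hr a.2, weight_of_mem 𝒜 _ a.2, mul_smul_comm]

/-- The inverse character appears because an alternating `c` is antisymmetric. -/
lemma twistMul_of_mem_right {x : G} {r : R} (hr : r ∈ 𝒜 x) (a : R) :
    twistMul 𝒜 c a r = r * weight 𝒜 (c (-x)) a := by
  induction a using Decomposition.inductionOn 𝒜 with
  | zero => simp
  | add a b ha hb => simp only [map_add, LinearMap.add_apply, mul_add, ha, hb]
  | @homogeneous y a =>
    rw [twistMul_of_mem 𝒜 c a.2 hr, weight_of_mem 𝒜 _ a.2, mul_smul_comm, c.map_neg_left,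
      ← c.map_swap, mul_comm r]

/-- The subspace of `R` underlying an ideal of the twist. -/
def untwist (J : TwoSidedIdeal (Twist 𝒜 c)) : Submodule k R where
  carrier := {r | toTwist 𝒜 c r ∈ J}
  zero_mem' := by simp [J.zero_mem]
  add_mem' {a b} ha hb := by
    simp only [Set.mem_ofPred_eq, map_add] at ha hb ⊢
    exact J.add_mem ha hb
  smul_mem' t a ha := by
    simp only [Set.mem_ofPred_eq, map_smul] at ha ⊢
    rw [Algebra.smul_def]
    exact J.mul_mem_left _ _ ha

variable {𝒜 c}

lemma mem_untwist {J : TwoSidedIdeal (Twist 𝒜 c)} {a : R} :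
    a ∈ untwist 𝒜 c J ↔ toTwist 𝒜 c a ∈ J := Iff.rfl

lemma coe_eq_image_iff {J : TwoSidedIdeal (Twist 𝒜 c)} {s : Set R} :
    (J : Set (Twist 𝒜 c)) = toTwist 𝒜 c '' s ↔ (untwist 𝒜 c J : Set R) = s := by
  constructor
  · intro h
    have := congrArg (toTwist 𝒜 c ⁻¹' ·) h
    rwa [Set.preimage_image_eq _ (toTwist 𝒜 c).injective] at this
  · rintro rfl
    exact (Set.image_preimage_eq _ (toTwist 𝒜 c).surjective).symm

lemma subset_image_iff {J : TwoSidedIdeal (Twist 𝒜 c)} {s : Set R} :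
    (J : Set (Twist 𝒜 c)) ⊆ toTwist 𝒜 c '' s ↔ (untwist 𝒜 c J : Set R) ⊆ s := by
  constructor
  · intro h a ha
    obtain ⟨b, hb, hab⟩ := h (a := toTwist 𝒜 c a) ha
    rwa [← (toTwist 𝒜 c).injective hab]
  · intro h a ha
    exact ⟨(toTwist 𝒜 c).symm a, h ha, by simp⟩

lemma untwist_le_untwist {J₁ J₂ : TwoSidedIdeal (Twist 𝒜 c)} :
    untwist 𝒜 c J₁ ≤ untwist 𝒜 c J₂ ↔ J₁ ≤ J₂ := Iff.rfl

lemma untwist_injective : Function.Injective (untwist 𝒜 c) := fun _ _ h =>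
  le_antisymm (untwist_le_untwist.1 h.le) (untwist_le_untwist.1 h.ge)

lemma twistMul_mem_untwist_left {J : TwoSidedIdeal (Twist 𝒜 c)} {a : R} (ha : a ∈ untwist 𝒜 c J)
    (r : R) : twistMul 𝒜 c r a ∈ untwist 𝒜 c J :=
  J.mul_mem_left (toTwist 𝒜 c r) _ ha

lemma twistMul_mem_untwist_right {J : TwoSidedIdeal (Twist 𝒜 c)} {a : R} (ha : a ∈ untwist 𝒜 c J)
    (r : R) : twistMul 𝒜 c a r ∈ untwist 𝒜 c J :=
  J.mul_mem_right _ (toTwist 𝒜 c r) ha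

variable (c) in
/-- An ideal of `R` which contains all components `R_x`, `x ∉ N`, and is stable under the
automorphisms given by `c(x, -)`, `x ∈ N`, is an ideal of the twist. -/
def twistIdeal (I : Ideal R) (N : AddSubgroup G) (hN : ∀ x ∉ N, ∀ r ∈ 𝒜 x, r ∈ I)
    (hI : ∀ x ∈ N, ∀ a ∈ I, weight 𝒜 (c x) a ∈ I) : TwoSidedIdeal (Twist 𝒜 c) :=
  TwoSidedIdeal.mk' {a | (toTwist 𝒜 c).symm a ∈ I} (by simp)
    (fun ha hb => by
      simp only [Set.mem_ofPred_eq, map_add] at ha hb ⊢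
      exact I.add_mem ha hb)
    (fun ha => by
      simp only [Set.mem_ofPred_eq, map_neg] at ha ⊢
      exact I.neg_mem ha)
    (fun {r a} ha => by
      change twistMul 𝒜 c ((toTwist 𝒜 c).symm r) ((toTwist 𝒜 c).symm a) ∈ I
      change (toTwist 𝒜 c).symm a ∈ I at ha
      generalize (toTwist 𝒜 c).symm r = r, (toTwist 𝒜 c).symm a = a at ha ⊢
      induction r using Decomposition.inductionOn 𝒜 with
      | zero => simp
      | add r s hr hs =>
        rw [map_add, LinearMap.add_apply]
        exact I.add_mem hr hs
      | @homogeneous x r =>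
        rw [twistMul_of_mem_left 𝒜 c r.2]
        by_cases hx : x ∈ N
        · exact I.mul_mem_left _ (hI x hx a ha)
        · exact I.mul_mem_right _ (hN x hx r r.2))
    (fun {a r} ha => by
      change twistMul 𝒜 c ((toTwist 𝒜 c).symm a) ((toTwist 𝒜 c).symm r) ∈ I
      change (toTwist 𝒜 c).symm a ∈ I at ha
      generalize (toTwist 𝒜 c).symm r = r, (toTwist 𝒜 c).symm a = a at ha ⊢
      induction r using Decomposition.inductionOn 𝒜 with
      | zero => simp
      | add r s hr hs =>
        rw [map_add]
        exact I.add_mem hr hs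
      | @homogeneous x r =>
        rw [twistMul_of_mem_right 𝒜 c r.2]
        by_cases hx : x ∈ N
        · exact I.mul_mem_left _ (hI _ (N.neg_mem hx) a ha)
        · exact I.mul_mem_right _ (hN x hx r r.2))

lemma mem_untwist_twistIdeal {I : Ideal R} {N : AddSubgroup G}
    {hN : ∀ x ∉ N, ∀ r ∈ 𝒜 x, r ∈ I} {hI : ∀ x ∈ N, ∀ a ∈ I, weight 𝒜 (c x) a ∈ I} {a : R} :
    a ∈ untwist 𝒜 c (twistIdeal c I N hN hI) ↔ a ∈ I := by
  rw [mem_untwist, twistIdeal, TwoSidedIdeal.mem_mk']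
  rfl

/-- If `a` is coherent then, modulo an ideal which contains the components outside `N`, twisted
left multiplication by `a` is multiplication by `a` composed with a weight operator. -/
lemma IsCoherent.twistMul_sub_mem {I : Ideal R} {N : AddSubgroup G}
    (hN : ∀ y ∉ N, ∀ r ∈ 𝒜 y, r ∈ I) {a : R} (ha : IsCoherent 𝒜 c N a) {y : G} (hy : y ∈ N)
    (hay : (decompose 𝒜 a y : R) ≠ 0) (b : R) :
    twistMul 𝒜 c a b - a * weight 𝒜 (c y) b ∈ I := by
  classical
  have key : ∀ z, twistMul 𝒜 c (decompose 𝒜 a z) b - decompose 𝒜 a z * weight 𝒜 (c y) b ∈ I := by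
    intro z
    rw [twistMul_of_mem_left 𝒜 c (SetLike.coe_mem _), ← mul_sub]
    by_cases hz : z ∈ N
    · by_cases h0 : (decompose 𝒜 a z : R) = 0
      · simp [h0]
      · refine I.mul_mem_left _ ?_
        refine weight_sub_weight_mem 𝒜 (K := I.restrictScalars k) (N := N) hN fun w hw _ => ?_
        rw [c.map_swap w z, c.map_swap w y, ha z hz y hy h0 hay w hw]
    · exact I.mul_mem_right _ (hN z hz _ (SetLike.coe_mem _))
  have h := I.sum_mem (t := (decompose 𝒜 a).support) fun z _ => key z
  rwa [Finset.sum_sub_distrib, ← Finset.sum_mul, ← LinearMap.sum_apply, ← map_sum,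
    sum_support_decompose] at h

end TwistMul

/-! ### Degree subgroups and cores. -/

variable {𝒜 c}

variable (𝒜 c) in
/-- The subgroup generated by the degrees of the homogeneous elements outside of `K`. -/
def degreeSubgroup (K : Set R) : AddSubgroup G :=
  AddSubgroup.closure {x | ∃ r ∈ 𝒜 x, r ∉ K}

variable (𝒜 c) in
/-- The elements whose images under the automorphisms given by `c(x, -)`, `x ∈ N`, all lie
in `I`. -/
def core (N : AddSubgroup G) (I : Ideal R) : Ideal R :=
  ⨅ x ∈ N, I.comap (charAut 𝒜 (c.toChar x))

omit [DecidableEq G] [GradedAlgebra 𝒜] in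
lemma mem_of_notMem_degreeSubgroup {K : Set R} :
    ∀ x ∉ degreeSubgroup 𝒜 K, ∀ r ∈ 𝒜 x, r ∈ K := by
  intro x hx r hr
  by_contra h
  exact hx (AddSubgroup.subset_closure ⟨r, hr, h⟩)

lemma mem_core {N : AddSubgroup G} {I : Ideal R} {a : R} :
    a ∈ core 𝒜 c N I ↔ ∀ x ∈ N, weight 𝒜 (c x) a ∈ I := by
  simp only [core, Ideal.mem_iInf, Ideal.mem_comap]
  rfl

lemma core_le (N : AddSubgroup G) (I : Ideal R) : core 𝒜 c N I ≤ I := by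
  intro a ha
  rw [← weight_zero_apply 𝒜 c a]
  exact mem_core.1 ha 0 N.zero_mem

lemma weight_mem_core {N : AddSubgroup G} {I : Ideal R} {x : G} (hx : x ∈ N) {a : R}
    (ha : a ∈ core 𝒜 c N I) : weight 𝒜 (c x) a ∈ core 𝒜 c N I := by
  rw [mem_core] at ha ⊢
  intro y hy
  rw [← weight_add_apply]
  exact ha _ (N.add_mem hy hx)

lemma weight_mem_core_iff {N : AddSubgroup G} {I : Ideal R} {x : G} (hx : x ∈ N) {a : R} :
    weight 𝒜 (c x) a ∈ core 𝒜 c N I ↔ a ∈ core 𝒜 c N I := by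
  refine ⟨fun h => ?_, weight_mem_core hx⟩
  rw [← weight_neg_weight 𝒜 c x a]
  exact weight_mem_core (N.neg_mem hx) h

/-- Weights only rescale homogeneous elements. Thus an ideal and its core have the same homogeneous
elements, and so the same degree subgroup. -/
lemma mem_core_of_mem_of_mem {N : AddSubgroup G} {I : Ideal R} {x : G} {a : R} (ha : a ∈ 𝒜 x)
    (haI : a ∈ I) : a ∈ core 𝒜 c N I := by
  rw [mem_core]
  intro y _
  rw [weight_of_mem 𝒜 _ ha]
  exact Submodule.smul_of_tower_mem I _ haI

lemma core_eq_self {N : AddSubgroup G} {I : Ideal R}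
    (h : ∀ x ∈ N, ∀ a ∈ I, weight 𝒜 (c x) a ∈ I) : core 𝒜 c N I = I :=
  le_antisymm (core_le N I) fun a ha => mem_core.2 fun x hx => h x hx a ha

lemma core_mono {N : AddSubgroup G} {I J : Ideal R} (h : I ≤ J) :
    core 𝒜 c N I ≤ core 𝒜 c N J := fun _ ha =>
  mem_core.2 fun x hx => h (mem_core.1 ha x hx)

lemma mul_mem_core {N : AddSubgroup G} {I J L : Ideal R} (h : I * J ≤ L) {a b : R}
    (ha : a ∈ core 𝒜 c N I) (hb : b ∈ core 𝒜 c N J) : a * b ∈ core 𝒜 c N L := by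
  rw [mem_core] at ha hb ⊢
  intro x hx
  rw [weight_bichar_mul]
  exact h (Ideal.mul_mem_mul (ha x hx) (hb x hx))

/-! ### The core of a prime: maximality and primeness in the twist. -/

section Prime

variable {P : Ideal R} [P.IsPrime]

lemma mem_core_of_mul_mem {N : AddSubgroup G} {d : G} {m a : R} (hm : m ∈ 𝒜 d) (hmP : m ∉ P)
    (h : m * a ∈ core 𝒜 c N P) : a ∈ core 𝒜 c N P := by
  rw [mem_core] at h ⊢
  intro x hx
  have h1 := h x hx
  rw [weight_bichar_mul, weight_of_mem 𝒜 _ hm] at h1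
  refine (Ideal.IsPrime.mem_or_mem ‹_› h1).resolve_left fun h2 => hmP ?_
  exact ((P.restrictScalars k).smul_mem_iff (Units.ne_zero _)).1 h2

/-- Weight operators on ideals of the twist, up to multiplication by homogeneous elements. -/
lemma exists_mul_weight_mem {x : G} (hx : x ∈ degreeSubgroup 𝒜 (P : Set R)) :
    ∃ d, ∃ m ∈ 𝒜 d, m ∉ P ∧ ∀ (J : TwoSidedIdeal (Twist 𝒜 c)), ∀ a ∈ untwist 𝒜 c J,
      m * weight 𝒜 (c x) a ∈ untwist 𝒜 c J := by
  induction hx using AddSubgroup.closure_induction'' with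
  | zero =>
    refine ⟨0, 1, SetLike.one_mem_graded 𝒜, (Ideal.ne_top_iff_one P).1 Ideal.IsPrime.ne_top',
      fun J a ha => ?_⟩
    rwa [weight_zero_apply, one_mul]
  | mem x hx =>
    obtain ⟨m, hm, hmP⟩ := hx
    refine ⟨x, m, hm, hmP, fun J a ha => ?_⟩
    rw [← twistMul_of_mem_left 𝒜 c hm]
    exact twistMul_mem_untwist_left ha m
  | neg_mem x hx =>
    obtain ⟨m, hm, hmP⟩ := hx
    refine ⟨x, m, hm, hmP, fun J a ha => ?_⟩
    rw [← twistMul_of_mem_right 𝒜 c hm]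
    exact twistMul_mem_untwist_right ha m
  | add x y _ _ hx hy =>
    obtain ⟨d, m, hm, hmP, h⟩ := hx
    obtain ⟨e, n, hn, hnP, h'⟩ := hy
    refine ⟨d + e, m * n, SetLike.mul_mem_graded hm hn, fun hmn => ?_, fun J a ha => ?_⟩
    · exact (Ideal.IsPrime.mem_or_mem ‹_› hmn).elim hmP hnP
    · have h1 := h J _ (h' J a ha)
      rw [weight_bichar_mul, weight_of_mem 𝒜 _ hn, smul_mul_assoc, mul_smul_comm,
        ← weight_add_apply, ← mul_assoc] at h1
      exact (Submodule.smul_mem_iff _ (Units.ne_zero _)).1 h1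

/-- Reweighting stays in `J` up to a homogeneous factor outside `P`, which the prime `P` lets one
cancel. -/
lemma untwist_le_core {J : TwoSidedIdeal (Twist 𝒜 c)}
    (hJ : (untwist 𝒜 c J : Set R) ⊆ P) {a : R} (ha : a ∈ untwist 𝒜 c J) :
    a ∈ core 𝒜 c (degreeSubgroup 𝒜 (P : Set R)) P := by
  rw [mem_core]
  intro x hx
  obtain ⟨d, m, -, hmP, h⟩ := exists_mul_weight_mem (c := c) hx
  exact (Ideal.IsPrime.mem_or_mem ‹_› (hJ (h J a ha))).resolve_left hmP

/-- Shifting all degrees by `d` multiplies the values to be compared by the common factor c(x,d). -/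
lemma IsCoherent.mul_left {N : AddSubgroup G} {a m : R} {d : G} (ha : IsCoherent 𝒜 c N a)
    (hm : m ∈ 𝒜 d) (hd : d ∈ N) : IsCoherent 𝒜 c N (m * a) := by
  intro y hy z hz hay haz x hx
  have key : ∀ y, (decompose 𝒜 (m * a) y : R) = m * decompose 𝒜 a (-d + y) := by
    intro y
    rw [← coe_decompose_mul_add_of_left_mem 𝒜 hm, add_neg_cancel_left]
  rw [key] at hay haz
  have := ha (-d + y) (N.add_mem (N.neg_mem hd) hy) (-d + z) (N.add_mem (N.neg_mem hd) hz)
    (right_ne_zero_of_mul hay) (right_ne_zero_of_mul haz) x hx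
  rwa [c.map_add_right, c.map_add_right, mul_right_inj] at this

/-- An ideal of the twist not contained in the core of `P` contains a coherent element outside of
this core. -/
lemma exists_isCoherent (hc : c.SquareFaithful) {J : TwoSidedIdeal (Twist 𝒜 c)} {a : R}
    (ha : a ∈ untwist 𝒜 c J) (haP : a ∉ core 𝒜 c (degreeSubgroup 𝒜 (P : Set R)) P) :
    ∃ b ∈ untwist 𝒜 c J, b ∉ core 𝒜 c (degreeSubgroup 𝒜 (P : Set R)) P ∧
      IsCoherent 𝒜 c (degreeSubgroup 𝒜 (P : Set R)) b := by
  classical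
  by_contra! hJ
  -- The elimination stays in `J` only after multiplication by homogeneous elements outside `P`; `m`
  -- collects these factors.
  suffices H : ∀ F : Finset G, ∀ a m : R, ∀ d, m ∈ 𝒜 d → m ∉ P → m * a ∈ untwist 𝒜 c J →
      (∀ y ∉ F, (decompose 𝒜 a y : R) = 0) →
      a ∈ core 𝒜 c (degreeSubgroup 𝒜 (P : Set R)) P by
    refine haP (H (decompose 𝒜 a).support a 1 0 (SetLike.one_mem_graded 𝒜)
      ((Ideal.ne_top_iff_one P).1 Ideal.IsPrime.ne_top') (by rwa [one_mul]) fun y hy => ?_)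
    rw [DFinsupp.notMem_support_iff.1 hy]
    rfl
  intro F
  induction F using Finset.strongInduction with
  | H F ih =>
    intro a m d hm hmP hma hF
    have hd : d ∈ degreeSubgroup 𝒜 (P : Set R) := AddSubgroup.subset_closure ⟨m, hm, hmP⟩
    by_cases hcoh : IsCoherent 𝒜 c (degreeSubgroup 𝒜 (P : Set R)) a
    · by_contra h
      exact hJ _ hma (fun h' => h (mem_core_of_mul_mem hm hmP h')) (hcoh.mul_left hm hd)
    simp only [IsCoherent, not_forall] at hcoh
    obtain ⟨y, hy, z, hz, hay, haz, hne⟩ := hcoh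
    have hne' : ∃ x, (∃ r ∈ 𝒜 x, r ∉ P) ∧ c x y ≠ c x z := by
      by_contra! h'
      obtain ⟨x, hx, hxx⟩ := hne
      exact hxx (c.eq_of_forall_closure (D := {x | ∃ r ∈ 𝒜 x, r ∉ P}) h' x hx)
    obtain ⟨x, ⟨n, hn, hnP⟩, hxyz⟩ := hne'
    have hx : x ∈ degreeSubgroup 𝒜 (P : Set R) := AddSubgroup.subset_closure ⟨n, hn, hnP⟩
    have hl : n * m * weight 𝒜 (c x) a ∈ untwist 𝒜 c J := by
      have := twistMul_mem_untwist_left hma n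
      rw [twistMul_of_mem_left 𝒜 c hn, weight_bichar_mul, weight_of_mem 𝒜 _ hm, smul_mul_assoc,
        mul_smul_comm, ← mul_assoc] at this
      exact (Submodule.smul_mem_iff _ (Units.ne_zero _)).1 this
    have hr : n * m * weight 𝒜 (c (-x)) a ∈ untwist 𝒜 c J := by
      have := twistMul_mem_untwist_right hma n
      rw [twistMul_of_mem_right 𝒜 c hn, weight_bichar_mul, weight_of_mem 𝒜 _ hm, smul_mul_assoc,
        mul_smul_comm, ← mul_assoc] at this
      exact (Submodule.smul_mem_iff _ (Units.ne_zero _)).1 this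
    -- The coefficient c(x,w)² cancels the component of degree `w`, as c(-x,w) is the inverse of
    -- c(x,w). The difference of the cases `y` and `z` has coefficient c(x,y)² - c(x,z)², nonzero by
    -- `hc`.
    have key : ∀ w, (decompose 𝒜 a w : R) ≠ 0 →
        (c x w * c x w : k) • weight 𝒜 (c (-x)) a - weight 𝒜 (c x) a ∈
          core 𝒜 c (degreeSubgroup 𝒜 (P : Set R)) P := by
      intro w hw
      have hwF : w ∈ F := by
        by_contra h'
        exact hw (hF w h')
      refine ih (F.erase w) (Finset.erase_ssubset hwF) _ (n * m) (x + d)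
        (SetLike.mul_mem_graded hn hm) (fun h => ?_) ?_ fun v hv => ?_
      · exact (Ideal.IsPrime.mem_or_mem ‹_› h).elim hnP hmP
      · rw [mul_sub, mul_smul_comm]
        exact Submodule.sub_mem _ (Submodule.smul_mem _ _ hr) hl
      · rw [decompose_sub, decompose_smul]
        change (c x w * c x w : k) • (decompose 𝒜 (weight 𝒜 (c (-x)) a) v : R) -
          (decompose 𝒜 (weight 𝒜 (c x) a) v : R) = 0
        rw [decompose_weight, decompose_weight]
        by_cases hvw : v = w
        · rw [hvw, smul_smul, c.map_neg_left, mul_assoc, Units.mul_inv, mul_one, sub_self]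
        · rw [hF v fun h' => hv (Finset.mem_erase.2 ⟨hvw, h'⟩), smul_zero, smul_zero, smul_zero,
            sub_self]
    have h1 := Ideal.sub_mem _ (key y hay) (key z haz)
    rw [sub_sub_sub_cancel_right, ← sub_smul] at h1
    rw [← weight_mem_core_iff (neg_mem hx)]
    refine (Submodule.smul_mem_iff
      ((core 𝒜 c (degreeSubgroup 𝒜 (P : Set R)) P).restrictScalars k) ?_).1 h1
    rw [sub_ne_zero]
    exact fun h' => hxyz (hc.eq_of_mul_self_eq (Units.ext (by simpa using h')))

variable (P) in
/-- The core of `P` as an ideal of the twist. For prime `P` it is the largest ideal of the twist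
contained in `P'`. -/
def coreIdeal : TwoSidedIdeal (Twist 𝒜 c) :=
  twistIdeal c (core 𝒜 c (degreeSubgroup 𝒜 (P : Set R)) P) (degreeSubgroup 𝒜 (P : Set R))
    (fun x hx _ hr => mem_core_of_mem_of_mem hr (mem_of_notMem_degreeSubgroup x hx _ hr))
    (fun _ hx _ ha => weight_mem_core hx ha)

omit [P.IsPrime] in
lemma mem_untwist_coreIdeal {a : R} :
    a ∈ untwist 𝒜 c (coreIdeal P) ↔ a ∈ core 𝒜 c (degreeSubgroup 𝒜 (P : Set R)) P :=
  mem_untwist_twistIdeal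

/-- Twisted multiplication by a coherent element is, modulo `P`, ordinary multiplication after a
reweighting, so primeness of `P` can be applied. -/
lemma coreIdeal_le_or_le (hc : c.SquareFaithful) (I J : TwoSidedIdeal (Twist 𝒜 c))
    (h : ∀ a ∈ I, ∀ b ∈ J, a * b ∈ coreIdeal P) : I ≤ coreIdeal P ∨ J ≤ coreIdeal P := by
  by_contra! hIJ
  rw [← untwist_le_untwist, ← untwist_le_untwist, SetLike.not_le_iff_exists,
    SetLike.not_le_iff_exists] at hIJ
  obtain ⟨⟨a, ha, haP⟩, b, hb, hbP⟩ := hIJ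
  rw [mem_untwist_coreIdeal] at haP hbP
  obtain ⟨a, ha, haP, hcoh⟩ := exists_isCoherent hc ha haP
  have hN := mem_of_notMem_degreeSubgroup (𝒜 := 𝒜) (K := (P : Set R))
  rw [mem_core] at haP hbP
  push Not at haP hbP
  obtain ⟨e, he, haP⟩ := haP
  obtain ⟨f, hf, hbP⟩ := hbP
  -- Otherwise all components of `a`, and hence all its reweightings, lie in `P`.
  obtain ⟨y, hy, hay⟩ : ∃ y ∈ degreeSubgroup 𝒜 (P : Set R), (decompose 𝒜 a y : R) ≠ 0 := by
    by_contra! h0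
    have := weight_sub_weight_mem 𝒜 (K := P.restrictScalars k)
      (N := degreeSubgroup 𝒜 (P : Set R)) hN (χ := c e)
      (ψ := fun _ => 1) (a := a) fun y hy h' => absurd (h0 y hy) h'
    refine haP ((Submodule.sub_mem_iff_left P ?_).1 this)
    rw [weight_const, Units.val_one, one_smul]
    refine mem_of_components 𝒜 (K := P.restrictScalars k) fun y => ?_
    by_cases hy : y ∈ degreeSubgroup 𝒜 (P : Set R)
    · rw [h0 y hy]
      exact Submodule.zero_mem _
    · exact hN y hy _ (SetLike.coe_mem _)
  have haP' : a ∉ P := by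
    intro h0
    have := hcoh.weight_sub_smul_mem (K := P.restrictScalars k) (χ := c e) hN
      (fun _ _ _ _ h => h e he) hy hay
    exact haP ((Submodule.sub_mem_iff_left P (Submodule.smul_of_tower_mem P _ h0)).1 this)
  -- Multiplying by `a` will reweight the right factor by c(y,-); starting from `f - y` makes the
  -- total c(f,-).
  obtain ⟨d, m, hm, hmP, hmJ⟩ := exists_mul_weight_mem (c := c) (AddSubgroup.sub_mem _ hf hy)
  have h1 : twistMul 𝒜 c a (m * weight 𝒜 (c (f - y)) b) ∈ P :=
    core_le _ _ (mem_untwist_coreIdeal.1 (h _ ha _ (hmJ J b hb)))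
  have h2 := (Submodule.sub_mem_iff_right P h1).1 (hcoh.twistMul_sub_mem hN hy hay _)
  have h3 := (Ideal.IsPrime.mem_or_mem ‹_› h2).resolve_left haP'
  rw [weight_bichar_mul, weight_of_mem 𝒜 _ hm, smul_mul_assoc, ← weight_add_apply,
    add_sub_cancel] at h3
  have h4 : m * weight 𝒜 (c f) b ∈ P :=
    ((P.restrictScalars k).smul_mem_iff (Units.ne_zero _)).1 h3
  exact (Ideal.IsPrime.mem_or_mem ‹_› h4).elim hmP hbP

end Prime

/-! ### The canonical map. -/

/-- The canonical map from the spectrum of `R` to the spectrum of the twist. -/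
def canonicalMap (hc : c.SquareFaithful) (P : PrimeSpectrum R) :
    NCPrimeSpectrum (Twist 𝒜 c) where
  asIdeal := coreIdeal P.asIdeal
  ne_top h := by
    have h1 : (1 : R) ∈ untwist 𝒜 c (coreIdeal P.asIdeal) := by
      rw [h, mem_untwist]
      trivial
    exact (Ideal.ne_top_iff_one _).1 P.isPrime.ne_top (core_le _ _ (mem_untwist_coreIdeal.1 h1))
  le_or_le := coreIdeal_le_or_le hc

lemma mem_canonicalMap {hc : c.SquareFaithful} {P : PrimeSpectrum R} {a : R} :
    a ∈ untwist 𝒜 c (canonicalMap hc P).asIdeal ↔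
      a ∈ core 𝒜 c (degreeSubgroup 𝒜 (P.asIdeal : Set R)) P.asIdeal :=
  mem_untwist_coreIdeal

lemma canonicalMap_subset (hc : c.SquareFaithful) (P : PrimeSpectrum R) :
    (untwist 𝒜 c (canonicalMap hc P).asIdeal : Set R) ⊆ P.asIdeal := fun _ ha =>
  core_le _ _ (mem_canonicalMap.1 ha)

lemma le_canonicalMap_iff {hc : c.SquareFaithful} {P : PrimeSpectrum R}
    {J : TwoSidedIdeal (Twist 𝒜 c)} :
    J ≤ (canonicalMap hc P).asIdeal ↔ (untwist 𝒜 c J : Set R) ⊆ P.asIdeal :=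
  ⟨fun h _ ha => canonicalMap_subset hc P (untwist_le_untwist.2 h ha), fun h =>
    untwist_le_untwist.1 fun _ ha => mem_canonicalMap.2 (untwist_le_core h ha)⟩

lemma canonicalMap_isGreatest (hc : c.SquareFaithful) (P : PrimeSpectrum R) :
    IsGreatest {I : TwoSidedIdeal (Twist 𝒜 c) |
      (I : Set (Twist 𝒜 c)) ⊆ toTwist 𝒜 c '' (P.asIdeal : Set R)}
      (canonicalMap hc P).asIdeal :=
  ⟨subset_image_iff.2 (canonicalMap_subset hc P),
    fun _ hJ => le_canonicalMap_iff.2 (subset_image_iff.1 hJ)⟩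

/-! ### Equivariance and the orbit formula. -/

section Action

lemma mem_specAct {h : AddChar G kˣ} {P : PrimeSpectrum R} {a : R} :
    a ∈ (specAct 𝒜 h P).asIdeal ↔ weight 𝒜 (h⁻¹ : AddChar G kˣ) a ∈ P.asIdeal := Iff.rfl

lemma mem_specAct_inv {h : AddChar G kˣ} {P : PrimeSpectrum R} {a : R} :
    a ∈ (specAct 𝒜 h⁻¹ P).asIdeal ↔ weight 𝒜 h a ∈ P.asIdeal := by
  have h' : (h⁻¹)⁻¹ = h := inv_inv h
  rw [mem_specAct, h']

lemma mem_specAct_of_mem {h : AddChar G kˣ} {P : PrimeSpectrum R} {x : G} {a : R}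
    (ha : a ∈ 𝒜 x) : a ∈ (specAct 𝒜 h P).asIdeal ↔ a ∈ P.asIdeal := by
  rw [mem_specAct, weight_of_mem 𝒜 _ ha]
  exact (P.asIdeal.restrictScalars k).smul_mem_iff (Units.ne_zero _)

omit [DecidableEq G] [GradedAlgebra 𝒜] in
lemma degreeSubgroup_congr {K L : Set R} (h : ∀ x, ∀ r ∈ 𝒜 x, r ∈ K ↔ r ∈ L) :
    degreeSubgroup 𝒜 K = degreeSubgroup 𝒜 L := by
  have : {x | ∃ r ∈ 𝒜 x, r ∉ K} = {x | ∃ r ∈ 𝒜 x, r ∉ L} := by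
    ext x
    exact exists_congr fun r => and_congr_right fun hr => not_congr (h x r hr)
  rw [degreeSubgroup, this, degreeSubgroup]

lemma degreeSubgroup_specAct (h : AddChar G kˣ) (P : PrimeSpectrum R) :
    degreeSubgroup 𝒜 ((specAct 𝒜 h P).asIdeal : Set R) = degreeSubgroup 𝒜 (P.asIdeal : Set R) :=
  degreeSubgroup_congr fun _ _ hr => mem_specAct_of_mem hr

lemma mem_untwist_twistSpecAct {h : AddChar G kˣ} {Q : NCPrimeSpectrum (Twist 𝒜 c)} {a : R} :
    a ∈ untwist 𝒜 c (twistSpecAct 𝒜 c h Q).asIdeal ↔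
      weight 𝒜 (h⁻¹ : AddChar G kˣ) a ∈ untwist 𝒜 c Q.asIdeal := by
  change toTwist 𝒜 c a ∈ (twistCharAut 𝒜 c h).toRingEquiv.mapTwoSidedIdeal Q.asIdeal ↔ _
  rw [RingEquiv.mapTwoSidedIdeal_apply, TwoSidedIdeal.mem_comap]
  rfl

lemma canonicalMap_specAct (hc : c.SquareFaithful) (h : AddChar G kˣ) (P : PrimeSpectrum R) :
    canonicalMap hc (specAct 𝒜 h P) = twistSpecAct 𝒜 c h (canonicalMap hc P) := by
  refine NCPrimeSpectrum.ext (untwist_injective (Submodule.ext fun a => ?_))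
  rw [mem_untwist_twistSpecAct, mem_canonicalMap, mem_canonicalMap, degreeSubgroup_specAct,
    mem_core, mem_core]
  refine forall₂_congr fun x _ => ?_
  rw [mem_specAct, weight_comm]

/-- The translates defining the core of `P` all lie in one fibre, because the core is stable under
c(x,-). -/
lemma canonicalMap_specAct_toChar (hc : c.SquareFaithful) {P : PrimeSpectrum R} {x : G}
    (hx : x ∈ degreeSubgroup 𝒜 (P.asIdeal : Set R)) :
    canonicalMap (𝒜 := 𝒜) hc (specAct 𝒜 (c.toChar x)⁻¹ P) = canonicalMap hc P := by
  have h' : ((c.toChar x)⁻¹)⁻¹ = c.toChar x := inv_inv (c.toChar x)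
  rw [canonicalMap_specAct]
  refine NCPrimeSpectrum.ext (untwist_injective (Submodule.ext fun a => ?_))
  rw [mem_untwist_twistSpecAct, mem_canonicalMap, mem_canonicalMap, h']
  exact weight_mem_core_iff hx

lemma mem_orbitInf_perp {P : PrimeSpectrum R} {S : Set G} {a : R} :
    a ∈ orbitInf 𝒜 P (perp S) ↔ ∀ t ∈ perp (k := k) S, weight 𝒜 t a ∈ P.asIdeal := by
  simp only [orbitInf, Ideal.mem_iInf]
  have hinv : ∀ t ∈ perp (k := k) S, t⁻¹ ∈ perp (k := k) S := fun t ht x hx => by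
    rw [AddChar.inv_apply', ht x hx, inv_one]
  exact ⟨fun h t ht => mem_specAct_inv.1 (h _ (hinv t ht)), fun h t ht => h _ (hinv t ht)⟩

/-- A character trivial on the radical cannot separate degrees of `N` that all c(x,-) identify, so
it preserves the core. Conversely each c(x,-) with `x ∈ N` is trivial on the radical. -/
lemma core_eq_orbitInf {N : AddSubgroup G} (P : PrimeSpectrum R)
    (hN : ∀ x ∉ N, ∀ r ∈ 𝒜 x, r ∈ P.asIdeal) :
    core 𝒜 c N P.asIdeal = orbitInf 𝒜 P (perp (c.radicalOn N)) := by
  ext a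
  rw [mem_orbitInf_perp]
  constructor
  · intro ha t ht
    refine core_le N _ (weight_mem_of_stable (K := (core 𝒜 c N P.asIdeal).restrictScalars k)
      (c := c) (X := N) (fun y hy r hr => mem_core_of_mem_of_mem hr (hN y hy r hr))
      (fun x hx a ha => weight_mem_core hx ha) (fun _ _ _ _ h => h) (fun y hy z hz h => ?_) ha)
    have hyz : y - z ∈ c.radicalOn N := by
      refine ⟨N.sub_mem hy hz, fun x hx => ?_⟩
      rw [c.map_swap, c.map_sub_right, h x hx, div_self', inv_one]
    rw [← sub_add_cancel y z, t.map_add_eq_mul, ht _ hyz, one_mul]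
  · intro h
    refine mem_core.2 fun x hx => h (c.toChar x) fun s hs => ?_
    rw [c.coe_toChar, c.map_swap, hs.2 x hx, inv_one]

end Action

/-! ### Degree subgroups from generators. -/

section Stratum

lemma degreeSubgroup_eq_stratumSubgroup {n : ℕ} {r : Fin n → R} {δ : Fin n → G}
    (hr : ∀ i, r i ∈ 𝒜 (δ i)) (hgen : Algebra.adjoin k (Set.range r) = ⊤) {w : Set (Fin n)}
    {P : PrimeSpectrum R} (hP : P ∈ specStratum r w) :
    degreeSubgroup 𝒜 (P.asIdeal : Set R) = stratumSubgroup δ w := by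
  classical
  refine le_antisymm ?_ ?_
  · refine (AddSubgroup.closure_le _).2 ?_
    rintro x ⟨s, hs, hsP⟩
    by_contra hx
    -- Products are harmless: if a sum of two degrees is outside the subgroup, so is one of them.
    have H : ∀ a ∈ Algebra.adjoin k (Set.range r), ∀ y ∉ stratumSubgroup δ w,
        (decompose 𝒜 a y : R) ∈ P.asIdeal := by
      intro a ha
      induction ha using Algebra.adjoin_induction with
      | mem a ha =>
        obtain ⟨i, rfl⟩ := ha
        intro y hy
        by_cases hi : δ i = y
        · subst hi
          rw [decompose_of_mem_same 𝒜 (hr i)]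
          refine (hP i).2 ?_
          by_contra hiw
          exact hy (AddSubgroup.subset_closure ⟨i, hiw, rfl⟩)
        · rw [decompose_of_mem_ne 𝒜 (hr i) hi]
          exact Ideal.zero_mem _
      | algebraMap t =>
        intro y hy
        have h0 : (0 : G) ≠ y := fun h => hy (h ▸ zero_mem _)
        rw [decompose_of_mem_ne 𝒜 (SetLike.algebraMap_mem_graded 𝒜 t) h0]
        exact Ideal.zero_mem _
      | add a b _ _ ha hb =>
        intro y hy
        rw [decompose_add]
        exact P.asIdeal.add_mem (ha y hy) (hb y hy)
      | mul a b _ _ ha hb =>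
        intro y hy
        rw [decompose_mul, DirectSum.coe_mul_apply]
        refine Ideal.sum_mem _ fun ij hij => ?_
        obtain ⟨-, hij⟩ := Finset.mem_filter.1 hij
        by_cases h1 : ij.1 ∈ stratumSubgroup δ w
        · refine Ideal.mul_mem_left _ _ (hb _ fun h2 => hy ?_)
          rw [← hij]
          exact add_mem h1 h2
        · exact Ideal.mul_mem_right _ _ (ha _ h1)
    have := H s (hgen ▸ Algebra.mem_top) x hx
    rw [decompose_of_mem_same 𝒜 hs] at this
    exact hsP this
  · refine (AddSubgroup.closure_le _).2 ?_
    rintro _ ⟨i, hi, rfl⟩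
    exact AddSubgroup.subset_closure ⟨r i, hr i, fun h => hi ((hP i).1 h)⟩

end Stratum

/-! ### Surjectivity of the canonical map. -/

section Surjective

/-- Only left multiples of `I` and right multiples of `J` need an argument: `I` absorbs right
factors into `z`, and `J` is the right annihilator of `I` modulo `Q`. -/
lemma NCPrimeSpectrum.mem_or_mem {A : Type*} [Ring A] (Q : NCPrimeSpectrum A) {a b : A}
    (h : ∀ z, a * z * b ∈ Q.asIdeal) : a ∈ Q.asIdeal ∨ b ∈ Q.asIdeal := by
  let I : TwoSidedIdeal A := TwoSidedIdeal.mk' {x | ∀ z, x * z * b ∈ Q.asIdeal}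
    (fun z => by simp [Q.asIdeal.zero_mem])
    (fun hx hy z => by
      rw [add_mul, add_mul]
      exact Q.asIdeal.add_mem (hx z) (hy z))
    (fun hx z => by
      rw [neg_mul, neg_mul]
      exact Q.asIdeal.neg_mem (hx z))
    (fun {x y} hy z => by
      rw [mul_assoc, mul_assoc, ← mul_assoc y]
      exact Q.asIdeal.mul_mem_left _ _ (hy z))
    (fun {x y} hx z => by
      rw [mul_assoc x]
      exact hx (y * z))
  have hI : ∀ x, x ∈ I ↔ ∀ z, x * z * b ∈ Q.asIdeal := fun x => TwoSidedIdeal.mem_mk' ..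
  let J : TwoSidedIdeal A := TwoSidedIdeal.mk' {y | ∀ x ∈ I, x * y ∈ Q.asIdeal}
    (fun x _ => by simp [Q.asIdeal.zero_mem])
    (fun hy hz x hx => by
      rw [mul_add]
      exact Q.asIdeal.add_mem (hy x hx) (hz x hx))
    (fun hy x hx => by
      rw [mul_neg]
      exact Q.asIdeal.neg_mem (hy x hx))
    (fun {z y} hy x hx => by
      rw [← mul_assoc]
      exact hy _ (I.mul_mem_right _ _ hx))
    (fun {y z} hy x hx => by
      rw [← mul_assoc]
      exact Q.asIdeal.mul_mem_right _ _ (hy x hx))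
  have hJ : ∀ y, y ∈ J ↔ ∀ x ∈ I, x * y ∈ Q.asIdeal := fun y => TwoSidedIdeal.mem_mk' ..
  refine (Q.le_or_le I J fun x hx y hy => (hJ y).1 hy x hx).imp (fun h' => h' ((hI a).2 h))
    fun h' => h' ((hJ b).2 fun x hx => ?_)
  have := (hI x).1 hx 1
  rwa [mul_one] at this

lemma weight_twistMul (x : G) (a b : R) : weight 𝒜 (c x) (twistMul 𝒜 c a b) =
    twistMul 𝒜 c (weight 𝒜 (c x) a) (weight 𝒜 (c x) b) :=
  charAut_twistMul 𝒜 c (c.toChar x) a b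

variable (Q : NCPrimeSpectrum (Twist 𝒜 c))

/-- Moving `m` from the right to the left of an element reweights it by c(2x,-). So the reweighted
`a`, times anything, times `m` lies in `Q`, and `m` is not in `Q`. -/
lemma weight_add_self_mem_untwist {x : G} {m : R} (hm : m ∈ 𝒜 x)
    (hmQ : m ∉ untwist 𝒜 c Q.asIdeal) {a : R} (ha : a ∈ untwist 𝒜 c Q.asIdeal) :
    weight 𝒜 (c (x + x)) a ∈ untwist 𝒜 c Q.asIdeal := by
  refine (Q.mem_or_mem (a := toTwist 𝒜 c (weight 𝒜 (c (x + x)) a)) (b := toTwist 𝒜 c m)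
    fun z => ?_).resolve_right hmQ
  obtain ⟨z, rfl⟩ := (toTwist 𝒜 c).surjective z
  rw [toTwist_mul, toTwist_mul, ← mem_untwist, twistMul_of_mem_right 𝒜 c hm,
    ← weight_weight_neg 𝒜 c (x + x) z, ← weight_twistMul, weight_add_apply,
    weight_neg_weight, ← twistMul_of_mem_left 𝒜 c hm]
  exact twistMul_mem_untwist_left (twistMul_mem_untwist_right ha _) _

lemma weight_mem_untwist (hc : c.SquareFaithful) {x : G}
    (hx : x ∈ degreeSubgroup 𝒜 (untwist 𝒜 c Q.asIdeal : Set R)) {a : R}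
    (ha : a ∈ untwist 𝒜 c Q.asIdeal) : weight 𝒜 (c x) a ∈ untwist 𝒜 c Q.asIdeal := by
  refine weight_mem_of_stable (c := c)
    (N := degreeSubgroup 𝒜 (untwist 𝒜 c Q.asIdeal : Set R))
    (X := {y | ∃ x, y = x + x ∧ ∃ m ∈ 𝒜 x, m ∉ untwist 𝒜 c Q.asIdeal})
    mem_of_notMem_degreeSubgroup ?_ ?_ (fun _ _ _ _ h => h x hx) ha
  · rintro _ ⟨x, rfl, m, hm, hmQ⟩ a ha
    exact weight_add_self_mem_untwist Q hm hmQ ha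
  · intro y _ z _ h
    refine c.eq_of_forall_closure ?_
    rintro x ⟨m, hm, hmQ⟩
    have := h (x + x) ⟨x, rfl, m, hm, hmQ⟩
    rw [c.map_add_left, c.map_add_left] at this
    exact hc.eq_of_mul_self_eq this

/-- The ideal of `R` underlying a prime ideal of the twist. -/
def untwistIdeal (hc : c.SquareFaithful) : Ideal R where
  __ := (untwist 𝒜 c Q.asIdeal).toAddSubmonoid
  smul_mem' r a ha := by
    change r * a ∈ untwist 𝒜 c Q.asIdeal
    change a ∈ untwist 𝒜 c Q.asIdeal at ha
    induction r using Decomposition.inductionOn 𝒜 with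
    | zero =>
      rw [zero_mul]
      exact Submodule.zero_mem _
    | add r s hr hs =>
      rw [add_mul]
      exact Submodule.add_mem _ hr hs
    | @homogeneous x r =>
      rw [← weight_weight_neg 𝒜 c x a, ← twistMul_of_mem_left 𝒜 c r.2]
      by_cases hx : x ∈ degreeSubgroup 𝒜 (untwist 𝒜 c Q.asIdeal : Set R)
      · exact twistMul_mem_untwist_left (weight_mem_untwist Q hc (neg_mem hx) ha) _
      · exact twistMul_mem_untwist_right (mem_of_notMem_degreeSubgroup x hx r r.2) _

/-- For coherent `a` the twisted product is, modulo `I`, an ordinary product with a reweighting of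
`b`; coherent elements span `J₁`. -/
lemma twistMul_mem_of_forall_mul_mem {I J₁ J₂ : Ideal R} {N : AddSubgroup G}
    (hN : ∀ x ∉ N, ∀ r ∈ 𝒜 x, r ∈ I)
    (h₁ : ∀ x ∈ N, ∀ a ∈ J₁, weight 𝒜 (c x) a ∈ J₁)
    (h₂ : ∀ x ∈ N, ∀ a ∈ J₂, weight 𝒜 (c x) a ∈ J₂)
    (h : ∀ a ∈ J₁, ∀ b ∈ J₂, a * b ∈ I) {a b : R} (ha : a ∈ J₁) (hb : b ∈ J₂) :
    twistMul 𝒜 c a b ∈ I := by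
  suffices J₁.restrictScalars k ≤ (I.restrictScalars k).comap ((twistMul 𝒜 c).flip b) from this ha
  refine le_of_coherent_mem (c := c) (N := N) (X := N) h₁ (fun _ _ _ _ h => h)
    fun a ha hcoh => ?_
  by_cases h0 : ∃ y ∈ N, (decompose 𝒜 a y : R) ≠ 0
  · obtain ⟨y, hy, hay⟩ := h0
    exact (Submodule.sub_mem_iff_left I (h a ha _ (h₂ y hy b hb))).1
      (hcoh.twistMul_sub_mem hN hy hay b)
  · push Not at h0
    refine mem_of_components 𝒜 fun y => ?_
    by_cases hy : y ∈ N
    · rw [h0 y hy]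
      exact Submodule.zero_mem _
    · change twistMul 𝒜 c (decompose 𝒜 a y) b ∈ I
      rw [twistMul_of_mem_left 𝒜 c (SetLike.coe_mem _)]
      exact I.mul_mem_right _ (hN y hy _ (SetLike.coe_mem _))

lemma canonicalMap_surjective [IsNoetherianRing R] (hc : c.SquareFaithful) :
    Function.Surjective (canonicalMap (𝒜 := 𝒜) hc) := by
  intro Q
  let I := untwistIdeal Q hc
  let N := degreeSubgroup 𝒜 (I : Set R)
  have hIQ : ∀ a, a ∈ I ↔ a ∈ untwist 𝒜 c Q.asIdeal := fun _ => Iff.rfl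
  have hN : ∀ x ∉ N, ∀ r ∈ 𝒜 x, r ∈ I := mem_of_notMem_degreeSubgroup
  have hI : core 𝒜 c N I = I := core_eq_self fun x hx a ha => weight_mem_untwist Q hc hx ha
  -- If `x * y ∈ P` with neither factor in `P`, adjoining `x` or `y` to `P` gives cores not inside
  -- `I`. These are ideals of the twist with product in `Q`, against primeness of `Q`.
  obtain ⟨P, ⟨hIP, hP⟩, hmax⟩ := set_has_maximal_iff_noetherian.2 ‹IsNoetherianRing R›
    {P : Ideal R | I ≤ P ∧ core 𝒜 c N P ≤ I} ⟨I, le_rfl, hI.le⟩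
  have hcore : core 𝒜 c N P = I := le_antisymm hP (hI.ge.trans (core_mono hIP))
  have htop : P ≠ ⊤ := by
    rintro rfl
    have h1 : (1 : R) ∈ I := hP (mem_core.2 fun _ _ => trivial)
    refine Q.ne_top (top_le_iff.1 fun a _ => ?_)
    rw [← mul_one a]
    exact Q.asIdeal.mul_mem_left _ _ h1
  have hprime : Ideal.IsPrime P := by
    refine ⟨htop, fun {x y} hxy => ?_⟩
    by_contra! hne
    let J (z : R) : Ideal R := core 𝒜 c N (P ⊔ Ideal.span {z})
    have hIJ : ∀ z, I ≤ J z := fun z => hcore.ge.trans (core_mono le_sup_left)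
    have hst : ∀ z, ∀ u ∈ N, ∀ a ∈ J z, weight 𝒜 (c u) a ∈ J z := fun z u hu a ha =>
      weight_mem_core hu ha
    have hJ : ∀ z ∉ P, ¬ J z ≤ I := fun z hz h =>
      hmax (P ⊔ Ideal.span {z}) ⟨hIP.trans le_sup_left, h⟩
        (lt_of_le_of_ne le_sup_left fun h' => hz
          (h' ▸ (le_sup_right : _ ≤ P ⊔ _) (Ideal.mem_span_singleton_self z)))
    have hmul : (P ⊔ Ideal.span {x}) * (P ⊔ Ideal.span {y}) ≤ P := by
      rw [Ideal.sup_mul]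
      refine sup_le Ideal.mul_le_left ?_
      rw [Ideal.mul_sup]
      refine sup_le Ideal.mul_le_right ?_
      rwa [Ideal.span_singleton_mul_span_singleton, Ideal.span_singleton_le_iff_mem]
    let T (z : R) : TwoSidedIdeal (Twist 𝒜 c) :=
      twistIdeal c (J z) N (fun u hu r hr => hIJ z (hN u hu r hr)) (hst z)
    have hT : ∀ z a, a ∈ untwist 𝒜 c (T z) ↔ a ∈ J z := fun _ _ => mem_untwist_twistIdeal
    have hTT : T x ≤ Q.asIdeal ∨ T y ≤ Q.asIdeal := by
      refine Q.le_or_le _ _ fun a ha b hb => ?_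
      exact twistMul_mem_of_forall_mul_mem hN (hst x) (hst y)
        (fun a ha b hb => hcore.le (mul_mem_core hmul ha hb)) ((hT x a).1 ha) ((hT y b).1 hb)
    rcases hTT with h | h
    · exact hJ x hne.1 fun a ha => h ((hT x a).2 ha)
    · exact hJ y hne.2 fun a ha => h ((hT y a).2 ha)
  refine ⟨⟨P, hprime⟩, NCPrimeSpectrum.ext (untwist_injective (Submodule.ext fun a => ?_))⟩
  have hdeg : degreeSubgroup 𝒜 (P : Set R) = N := degreeSubgroup_congr fun x r hr =>
    ⟨fun h => hcore.le (mem_core_of_mem_of_mem hr h), fun h => hIP h⟩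
  rw [mem_canonicalMap, hdeg, hcore, hIQ]

end Surjective

/-! ### The quotient topology. -/

section Topology

lemma isQuotientMap_canonicalMap [IsNoetherianRing R] (hc : c.SquareFaithful) :
    Topology.IsQuotientMap (canonicalMap (𝒜 := 𝒜) hc) := by
  rw [Topology.isQuotientMap_iff_isClosed]
  refine ⟨canonicalMap_surjective hc, fun C => ⟨fun hC => ?_, fun hZ => ?_⟩⟩
  · obtain ⟨J, rfl⟩ := (isClosed_iff_zeroLocus C).1 hC
    refine (PrimeSpectrum.isClosed_iff_zeroLocus _).2 ⟨(untwist 𝒜 c J : Set R), ?_⟩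
    ext P
    exact le_canonicalMap_iff
  · rw [isClosed_iff_zeroLocus]
    -- The preimage of `C` is a union of fibres, so an element vanishing on it lies in the core of
    -- each of its points, hence in this intersection.
    refine ⟨sInf {J | ∃ P, canonicalMap hc P ∈ C ∧ (canonicalMap hc P).asIdeal = J}, ?_⟩
    ext Q
    refine ⟨fun hQ => ?_, fun hQ => ?_⟩
    · obtain ⟨P, rfl⟩ := canonicalMap_surjective hc Q
      change P ∈ canonicalMap hc ⁻¹' C
      rw [← hZ.closure_eq, ← PrimeSpectrum.zeroLocus_vanishingIdeal_eq_closure]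
      intro a ha
      rw [SetLike.mem_coe, PrimeSpectrum.mem_vanishingIdeal] at ha
      refine canonicalMap_subset hc P (hQ ((TwoSidedIdeal.mem_sInf _).2 ?_) :
        toTwist 𝒜 c a ∈ (canonicalMap hc P).asIdeal)
      rintro _ ⟨P', hP', rfl⟩
      rw [← mem_untwist, mem_canonicalMap, mem_core]
      intro x hx
      have h1 := ha (specAct 𝒜 (c.toChar x)⁻¹ P')
        (by rwa [Set.mem_preimage, canonicalMap_specAct_toChar hc hx])
      exact (mem_specAct_inv (h := c.toChar x)).1 h1
    · obtain ⟨P, rfl⟩ := canonicalMap_surjective hc Q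
      have hP : ∃ P', canonicalMap (𝒜 := 𝒜) hc P' ∈ C ∧
          (canonicalMap (𝒜 := 𝒜) hc P').asIdeal = (canonicalMap (𝒜 := 𝒜) hc P).asIdeal :=
        ⟨P, hQ, rfl⟩
      change sInf _ ≤ (canonicalMap (𝒜 := 𝒜) hc P).asIdeal
      exact sInf_le hP

lemma isCanonicalQuotient_canonicalMap [IsNoetherianRing R] (hc : c.SquareFaithful) :
    IsCanonicalQuotient 𝒜 c (canonicalMap hc) where
  isQuotientMap := isQuotientMap_canonicalMap hc
  equivariant := canonicalMap_specAct hc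
  eq_on_stratum n r δ hr hgen w P hP := by
    rw [coe_eq_image_iff, ← degreeSubgroup_eq_stratumSubgroup hr hgen hP,
      ← core_eq_orbitInf P mem_of_notMem_degreeSubgroup]
    ext a
    exact mem_canonicalMap
  isGreatest := canonicalMap_isGreatest hc

end Topology

/-! ### Comparing two twists. -/

section Comparison

variable {c₁ c₂ : AlternatingBicharacter G k}

/-- Degrees not separated by `c₂` are not separated by `c₁`, so the `c₂`-core is stable under the
weights of `c₁`. -/
lemma core_le_core (hc : ∀ x y : G, c₂ x y = 1 → c₁ x y = 1) {N : AddSubgroup G} {I : Ideal R}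
    (hN : ∀ x ∉ N, ∀ r ∈ 𝒜 x, r ∈ I) : core 𝒜 c₂ N I ≤ core 𝒜 c₁ N I := by
  intro a ha
  refine mem_core.2 fun x hx => core_le N I (weight_mem_of_stable
    (K := (core 𝒜 c₂ N I).restrictScalars k) (c := c₂) (X := N)
    (fun y hy r hr => mem_core_of_mem_of_mem hr (hN y hy r hr))
    (fun x hx a ha => weight_mem_core hx ha) (fun _ _ _ _ h => h) (fun y _ z _ h => ?_) ha)
  rw [← div_eq_one, ← c₁.map_sub_right]
  apply hc
  rw [c₂.map_sub_right, h x hx, div_self']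

/-- The common `c₁`-core determines the degree subgroup, and it contains the `c₂`-core of `P`. That
core is thus a `c₂`-stable part of `P'`. -/
lemma canonicalMap_eq_of_canonicalMap_eq (hc₁ : c₁.SquareFaithful) (hc₂ : c₂.SquareFaithful)
    (hc : ∀ x y : G, c₂ x y = 1 → c₁ x y = 1) {P P' : PrimeSpectrum R}
    (h : canonicalMap (𝒜 := 𝒜) hc₁ P = canonicalMap hc₁ P') :
    canonicalMap (𝒜 := 𝒜) hc₂ P = canonicalMap hc₂ P' := by
  suffices H : ∀ P P' : PrimeSpectrum R, canonicalMap (𝒜 := 𝒜) hc₁ P = canonicalMap hc₁ P' →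
      (canonicalMap (𝒜 := 𝒜) hc₂ P).asIdeal ≤ (canonicalMap hc₂ P').asIdeal from
    NCPrimeSpectrum.ext (le_antisymm (H P P' h) (H P' P h.symm))
  intro P P' h
  have hcore : ∀ a, a ∈ core 𝒜 c₁ (degreeSubgroup 𝒜 (P.asIdeal : Set R)) P.asIdeal ↔
      a ∈ core 𝒜 c₁ (degreeSubgroup 𝒜 (P'.asIdeal : Set R)) P'.asIdeal := by
    intro a
    rw [← mem_canonicalMap (hc := hc₁), ← mem_canonicalMap (hc := hc₁), h]
  have hdeg : degreeSubgroup 𝒜 (P.asIdeal : Set R) = degreeSubgroup 𝒜 (P'.asIdeal : Set R) :=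
    degreeSubgroup_congr fun x r hr =>
      ⟨fun h => core_le _ _ ((hcore r).1 (mem_core_of_mem_of_mem hr h)),
        fun h => core_le _ _ ((hcore r).2 (mem_core_of_mem_of_mem hr h))⟩
  rw [← untwist_le_untwist]
  intro a ha
  rw [mem_canonicalMap] at ha ⊢
  refine mem_core.2 fun x hx => core_le _ _ ((hcore _).1
    (core_le_core hc mem_of_notMem_degreeSubgroup (weight_mem_core (hdeg ▸ hx) ha)))

end Comparison

end

end CocycleTwist

open CocycleTwist in
theorem corollary4p9 {k R G : Type*} [Field k] [IsAlgClosed k] [CommRing R] [Algebra k R]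
    [Algebra.FiniteType k R] [AddCommGroup G] [DecidableEq G]
    (𝒜 : G → Submodule k R) [GradedAlgebra 𝒜]
    (c₁ c₂ : AlternatingBicharacter G k)
    (hneg : ((-1 : kˣ) ∉ c₁.imageSubgroup ∧ (-1 : kˣ) ∉ c₂.imageSubgroup) ∨ CharP k 2)
    (hc : ∀ x y : G, c₂ x y = 1 → c₁ x y = 1) :
    ∃ (φ₁ : PrimeSpectrum R → NCPrimeSpectrum (Twist 𝒜 c₁))
      (φ₂ : PrimeSpectrum R → NCPrimeSpectrum (Twist 𝒜 c₂)),
      IsCanonicalQuotient 𝒜 c₁ φ₁ ∧ IsCanonicalQuotient 𝒜 c₂ φ₂ ∧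
      ∃ φ : NCPrimeSpectrum (Twist 𝒜 c₁) → NCPrimeSpectrum (Twist 𝒜 c₂),
        Topology.IsQuotientMap φ ∧
        (∀ h Q, φ (twistSpecAct 𝒜 c₁ h Q) = twistSpecAct 𝒜 c₂ h (φ Q)) ∧
        φ ∘ φ₁ = φ₂ := by
  have hc₁ : c₁.SquareFaithful := .of_neg_one (hneg.imp_left And.left)
  have hc₂ : c₂.SquareFaithful := .of_neg_one (hneg.imp_left And.right)
  have : IsNoetherianRing R := Algebra.FiniteType.isNoetherianRing k R
  have q₁ := isCanonicalQuotient_canonicalMap (𝒜 := 𝒜) hc₁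
  have q₂ := isCanonicalQuotient_canonicalMap (𝒜 := 𝒜) hc₂
  refine ⟨canonicalMap hc₁, canonicalMap hc₂, q₁, q₂,
    -- The second canonical map is constant on the fibres of the first, so any section defines the
    -- factorization.
    fun Q => canonicalMap hc₂ (Function.surjInv (canonicalMap_surjective hc₁) Q), ?_⟩
  set φ : NCPrimeSpectrum (Twist 𝒜 c₁) → NCPrimeSpectrum (Twist 𝒜 c₂) :=
    fun Q => canonicalMap hc₂ (Function.surjInv (canonicalMap_surjective hc₁) Q)
  have hφ : ∀ P, φ (canonicalMap hc₁ P) = canonicalMap hc₂ P := fun P =>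
    canonicalMap_eq_of_canonicalMap_eq hc₁ hc₂ hc
      (Function.surjInv_eq (canonicalMap_surjective hc₁) _)
  have hcomp : φ ∘ canonicalMap hc₁ = canonicalMap hc₂ := funext hφ
  refine ⟨?_, fun h Q => ?_, hcomp⟩
  · have hcont : Continuous φ := by
      rw [q₁.isQuotientMap.continuous_iff, hcomp]
      exact q₂.isQuotientMap.continuous
    exact .of_comp q₁.isQuotientMap.continuous hcont (hcomp ▸ q₂.isQuotientMap)
  · obtain ⟨P, rfl⟩ := canonicalMap_surjective hc₁ Q
    rw [← canonicalMap_specAct, hφ, hφ, canonicalMap_specAct]
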